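/- A metric graph is the realization of a finite connected multigraph with edge lengths in $(0,\infty]$, where only leaf edges may have length $\infty$ and the leaf end of such an edge is then a point at infinity. The realization carries its (compact) topology and its path distance with values in $[0,\infty]$; any weighted graph realizing the space is called a model of it. $\mathrm{Rat}(\Gamma)$ is the set consisting of the constant function $-\infty$ and of all continuous piecewise linear functions $f:\Gamma\to\mathbb R\cup\{\pm\infty\}$ with integer slopes and finitely many pieces that take the values $\pm\infty$ only at points at infinity. Let $\Gamma$ be a metric graph, $K$ a finite group acting on $\Gamma$ by isometries (homeomorphisms that preserve the distance), and $D$ a $K$-invariant effective divisor on $\Gamma$. Let $R(D)^K$ be the tropical semimodule of all $K$-invariant $f\in \mathrm{Rat}(\Gamma)$ such that $f\equiv-\infty$ or $D+\mathrm{div}(f)\ge 0$, where $\mathrm{div}(f)$ is the divisor whose coefficient at $x$ is the sum of the outgoing slopes of $f$ at $x$. Let $F=\{f_0,\dots,f_n\}$, with all $f_i\not\equiv-\infty$, be a finite generating set of $R(D)^K$ as a tropical semimodule over $\mathbb T=\mathbb R\cup\{-\infty\}$ with the operations $\max$ and $+$, and let $$\phi_F:\Gamma\to \mathbb{TP}^n,\qquad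 x\mapsto (f_0(x):\dots:f_n(x)),$$ where $\mathbb{TP}^n=(\mathbb T^{n+1}\setminus\{(-\infty,\dots,-\infty)\})/\mathbb R$; at a point at infinity where some $f_i$ is $+\infty$ the value is the limit of the values at nearby finite points. Equip $\mathrm{Im}(\phi_F)$ with the subspace topology and with the path distance given by the lattice length: a segment from $u$ to $u+cw$, with $c>0$ and $w$ a primitive integer vector (modulo $\mathbb Z(1,\dots,1)$), has length $c$. A map $\varphi:\Gamma\to\Gamma'$ of metric graphs is a $K$-Galois covering (with edge-multiplicities) if there are models $G,G'$ of $\Gamma,\Gamma'$ and functions $m:E(G)\to\mathbb Z_{>0}$, $m':E(G')\to\mathbb Z_{>0}$ such that: $\varphi$ is continuous and maps vertices to vertices; the preimage of the interior of each edge of $G'$ is a union of interiors of edges of $G$; $\varphi$ maps each edge $e$ of $G$ onto an edge of $G'$ as a dilation by a positive integer $\deg_e(\varphi)$; $m$ is preserved by $K$; $K$ acts on every fibre of $\varphi$, transitively; and $\varphi$ is harmonic of degree $|K|$. If $\Gamma'$ is not a single point, the last condition means that $m(e)$ divides $m'(\varphi(e))$ for every edge $e$ of $G$, that for every $x\in\Gamma$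 the number $\deg_x(\varphi)=\sum_h \frac{m'(\varphi(e))}{m(e)}\deg_e(\varphi)$, summed over the half-edges $h$ at $x$ mapped to a half-edge $h'$ at $\varphi(x)$ (with $e$ the edge containing $h$), does not depend on $h'$, and that $\sum_{x\in\varphi^{-1}(x')}\deg_x(\varphi)=|K|$ for every $x'\in\Gamma'$. A map from a non-singleton to a singleton has degree $0$; a map between singletons is regarded as harmonic of every degree. The choice $m=1$, $m'=1$ gives $K$-Galois coverings without multiplicities. If $\phi_F$ induces a $K$-Galois covering $\phi:\Gamma\to\mathrm{Im}(\phi_F)$, for some edge-multiplicities, then $$\phi^*\bigl(\mathrm{Rat}(\mathrm{Im}(\phi_F))\bigr)=\{\,g\circ\phi \mid g\in \mathrm{Rat}(\mathrm{Im}(\phi_F))\,\}=\mathrm{Rat}(\Gamma)^K ,$$ where $\mathrm{Rat}(\Gamma)^K$ is the set of $K$-invariant elements of $\mathrm{Rat}(\Gamma)$. -/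

import Mathlib

open scoped ENNReal Topology

noncomputable section

namespace TropicalGraph

/-! ### Metric graphs as spaces with an extended distance -/

/-- An extended distance function `X × X → [0, ∞]`. The topology of a metric graph is kept
separate from it: a point at infinity is the limit of its ray, although it has distance `∞` to
every other point. -/
class GraphDist (X : Type*) where
  gdist : X → X → ℝ≥0∞

/-- `HasChain w x y r`: there is a chain `x = x₀, …, x_k = y` whose steps have lengths
`r₁, …, r_k` with `w x_{i-1} x_i r_i`, and `r = r₁ + ⋯ + r_k`. -/
inductive HasChain {X : Type*} (w : X → X → ℝ≥0∞ → Prop) : X → X → ℝ≥0∞ → Prop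
  | refl (x : X) : HasChain w x x 0
  | step {x y z : X} {r s : ℝ≥0∞} : w x y r → HasChain w y z s → HasChain w x z (r + s)

/-- The infimum of the lengths of all chains from `x` to `y` (`∞` if there is none). -/
def chainDist {X : Type*} (w : X → X → ℝ≥0∞ → Prop) (x y : X) : ℝ≥0∞ :=
  sInf {r | HasChain w x y r}

/-- A model `(G, l)` of the space `X`: a finite connected multigraph (loops allowed) with vertex
set `V ⊆ X`, edges `E` and lengths `len e ∈ (0, ∞]`, whose realization is `X`. The edge `e` is
parametrized by `[0, len e]` through `param e`; only the values on `[0, len e]` matter. An edge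
of infinite length is a leaf edge and its leaf end is the point with parameter `∞`. The distance
of `X` is the path distance of the edge-weighted graph. -/
structure Model (X : Type*) [TopologicalSpace X] [GraphDist X] where
  t2 : T2Space X
  connected : ConnectedSpace X
  V : Finset X
  E : Type
  fintypeE : Fintype E
  len : E → ℝ≥0∞
  len_pos : ∀ e, 0 < len e
  param : E → ℝ≥0∞ → X
  param_continuousOn : ∀ e, ContinuousOn (param e) (Set.Icc 0 (len e))
  param_zero_mem : ∀ e, param e 0 ∈ V
  param_len_mem : ∀ e, param e (len e) ∈ V
  param_notMem : ∀ e, ∀ t ∈ Set.Ioo 0 (len e), param e t ∉ V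
  param_inj : ∀ e e' s t, s ∈ Set.Ioo 0 (len e) → t ∈ Set.Ioo 0 (len e') →
    param e s = param e' t → e = e' ∧ s = t
  cover : ∀ x, x ∈ V ∨ ∃ e, ∃ t ∈ Set.Ioo 0 (len e), param e t = x
  infinite_leaf : ∀ e, len e = ⊤ → ∀ e',
    param e' 0 ≠ param e ⊤ ∧ (param e' (len e') = param e ⊤ → e' = e)
  gdist_eq : ∀ x y, GraphDist.gdist x y = chainDist (fun p q r =>
    ∃ e s t, s ≤ len e ∧ t ≤ len e ∧ param e s = p ∧ param e t = q ∧ r = (s - t) + (t - s)) x y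

attribute [instance] Model.fintypeE

/-- A metric graph is a space that has a model. -/
def IsMetricGraph (X : Type*) [TopologicalSpace X] [GraphDist X] : Prop :=
  Nonempty (Model X)

namespace Model

variable {X : Type*} [TopologicalSpace X] [GraphDist X]

/-- The relative interior of an edge. -/
def interior (M : Model X) (e : M.E) : Set X :=
  M.param e '' Set.Ioo 0 (M.len e)

/-- `x` is a point at infinity. -/
def AtInfinity (M : Model X) (x : X) : Prop :=
  ∃ e, M.len e = ⊤ ∧ M.param e ⊤ = x

/-- A half-edge is given by an edge and a direction along it (`true` for increasing parameter);
`M.IsHalfEdgeAt x h` says that `h` emanates from the point `x`. A point in the relative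
interior of an edge has two half-edges, and a loop contributes two half-edges at its vertex. -/
def IsHalfEdgeAt (M : Model X) (x : X) (h : M.E × Bool) : Prop :=
  ∃ t ≤ M.len h.1, M.param h.1 t = x ∧ (h.2 = true → t < M.len h.1) ∧ (h.2 = false → 0 < t)

/-- `f` is affine with integer slope `s e` (in the direction of the parametrization) on every
edge `e` of the model, and takes the values `±∞` only at points at infinity. -/
def AffineWith (M : Model X) (f : X → EReal) (s : M.E → ℤ) : Prop :=
  (∀ e, ∃ a : ℝ, ∀ t ≤ M.len e,
    f (M.param e t) = (a : EReal) + (((s e : ℤ) : ℝ) : EReal) * (t : EReal)) ∧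
  ∀ x, f x = ⊤ ∨ f x = ⊥ → M.AtInfinity x

open Classical in
/-- The sum of the outgoing slopes at `x` of a function with slopes `s` on the edges. -/
def ord (M : Model X) (s : M.E → ℤ) (x : X) : ℤ :=
  ∑ e : M.E, ((if M.param e 0 = x then s e else 0) -
    (if M.param e (M.len e) = x then s e else 0))

end Model

/-! ### Rational functions, divisors and the modules `R(D)` and `R(D)^K` -/

section Functions

variable (X : Type*) [TopologicalSpace X] [GraphDist X]

/-- `Rat(X)`: the constant function `-∞` and the piecewise linear functions with integer slopes
and finitely many pieces (the edges of some model), with values `±∞` only at points at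
infinity. -/
def RatFun : Set (X → EReal) :=
  {f | (∀ x, f x = ⊥) ∨ ∃ (M : Model X) (s : M.E → ℤ), M.AffineWith f s}

variable {X}

/-- `E = div(f)`, for a rational function `f` other than the constant `-∞`. -/
def IsDivOf (f : X → EReal) (E : X →₀ ℤ) : Prop :=
  ∃ (M : Model X) (s : M.E → ℤ), M.AffineWith f s ∧ ∀ x, E x = M.ord s x

/-- `R(D)`. -/
def RD (D : X →₀ ℤ) : Set (X → EReal) :=
  {f | (∀ x, f x = ⊥) ∨ ∃ E, IsDivOf f E ∧ 0 ≤ D + E}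

variable (K : Type*) [Group K] [MulAction K X]

/-- The action of `K` on `X` is by isometries (homeomorphisms that preserve the distance). -/
def IsIsometricAction (X : Type*) [TopologicalSpace X] [GraphDist X] [MulAction K X] : Prop :=
  ∀ σ : K, Continuous (fun x : X => σ • x) ∧
    ∀ x y : X, GraphDist.gdist (σ • x) (σ • y) = GraphDist.gdist x y

/-- `f` is `K`-invariant. -/
def IsInvariantFun (f : X → EReal) : Prop :=
  ∀ (σ : K) (x : X), f (σ • x) = f x

/-- The divisor `D` is `K`-invariant. -/
def IsInvariantDiv (D : X →₀ ℤ) : Prop :=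
  ∀ (σ : K) (x : X), D (σ • x) = D x

/-- `R(D)^K`. -/
def RDInv (D : X →₀ ℤ) : Set (X → EReal) :=
  {f | f ∈ RD D ∧ IsInvariantFun K f}

/-- `F` is a finite family that generates `R(D)^K` as a tropical semimodule: its members lie in
`R(D)^K`, and every element of `R(D)^K` is a tropical linear combination `max_i (a_i + F_i)`
with `a_i ∈ ℝ ∪ {-∞}`. (In `EReal`, `-∞ + ∞ = -∞`, so that the coefficient `-∞` gives the
constant function `-∞`.) -/
def Generates {m : ℕ} (F : Fin m → X → EReal) (D : X →₀ ℤ) : Prop :=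
  (∀ i, F i ∈ RDInv K D) ∧
  ∀ f ∈ RDInv K D, ∃ a : Fin m → EReal, (∀ i, a i ≠ ⊤) ∧
    ∀ x, f x = Finset.univ.sup (fun i => a i + F i x)

end Functions

/-! ### Tropical projective space and rational maps -/

/-- A vector of homogeneous coordinates: entries in `ℝ ∪ {-∞}`, not all equal to `-∞`. -/
def IsHomCoord {n : ℕ} (u : Fin (n + 1) → EReal) : Prop :=
  (∀ i, u i ≠ ⊤) ∧ ∃ i, u i ≠ ⊥

/-- Homogeneous coordinates up to a common real summand. -/
def homSetoid (n : ℕ) : Setoid {u : Fin (n + 1) → EReal // IsHomCoord u} where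
  r u v := ∃ c : ℝ, ∀ i, u.1 i = (c : EReal) + v.1 i
  iseqv :=
    { refl := fun u => ⟨0, fun i => by simp⟩
      symm := by
        rintro u v ⟨c, hc⟩
        refine ⟨-c, fun i => ?_⟩
        rw [hc i, ← add_assoc, ← EReal.coe_add]
        simp
      trans := by
        rintro u v w ⟨c, hc⟩ ⟨d, hd⟩
        refine ⟨c + d, fun i => ?_⟩
        rw [hc i, hd i, EReal.coe_add, add_assoc] }

/-- The tropical projective space `TP^n`. -/
def TP (n : ℕ) : Type := Quotient (homSetoid n)

instance (n : ℕ) : TopologicalSpace (TP n) :=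
  inferInstanceAs (TopologicalSpace (Quotient (homSetoid n)))

/-- The point of `TP^n` with given homogeneous coordinates. -/
def TP.mk {n : ℕ} (u : Fin (n + 1) → EReal) (hu : IsHomCoord u) : TP n :=
  Quotient.mk (homSetoid n) ⟨u, hu⟩

/-- The point of `TP^n` with given real homogeneous coordinates. -/
def TP.ofReal {n : ℕ} (u : Fin (n + 1) → ℝ) : TP n :=
  TP.mk (fun i => (u i : EReal)) ⟨fun _ => EReal.coe_ne_top _, ⟨0, EReal.coe_ne_bot _⟩⟩

instance (n : ℕ) : Nonempty (TP n) := ⟨TP.ofReal 0⟩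

/-- The rational map `x ↦ (F_0(x) : ⋯ : F_n(x))`. The formula is used literally wherever it
gives homogeneous coordinates; at a point (at infinity) where some `F_i` takes the value `+∞`
it is read as the limit of `(F_0(y) : ⋯ : F_n(y))` for `y → x`, where `y` runs through the points
at which all `F_i` are real. -/
def ratMap {X : Type*} [TopologicalSpace X] {n : ℕ} (F : Fin (n + 1) → X → EReal) (x : X) :
    TP n :=
  open Classical in
  if h : IsHomCoord (fun i => F i x) then TP.mk (fun i => F i x) h
  else Filter.limUnder (𝓝[{y | ∀ i, F i y ≠ ⊤ ∧ F i y ≠ ⊥}] x)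
    (fun y => TP.ofReal (fun i => (F i y).toReal))

/-- `p` and `q` are the ends of a straight segment in `S ⊆ TP^n` of lattice length `r`: in suitable
real homogeneous coordinates, `q - p = c • w` with `c > 0` and a primitive integer vector `w`
(the greatest common divisor of the differences of its entries is one), and `r = c`. -/
def LatticeSegment {n : ℕ} (S : Set (TP n)) (p q : TP n) (r : ℝ≥0∞) : Prop :=
  ∃ (u : Fin (n + 1) → ℝ) (w : Fin (n + 1) → ℤ) (c : ℝ), 0 < c ∧
    Finset.univ.gcd (fun i => w i - w 0) = 1 ∧
    p = TP.ofReal u ∧ q = TP.ofReal (fun i => u i + c * w i) ∧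
    (∀ t ∈ Set.Icc (0 : ℝ) c, TP.ofReal (fun i => u i + t * w i) ∈ S) ∧
    r = ENNReal.ofReal c

/-- The distance on a subset of `TP^n`: the infimum of the lattice lengths of the polygonal paths
inside the subset. -/
instance {n : ℕ} (S : Set (TP n)) : GraphDist S where
  gdist := chainDist (fun p q r => LatticeSegment S p.1 q.1 r)

/-! ### Harmonic morphisms with edge-multiplicities and Galois coverings -/

section Morphisms

variable {X Y : Type*} [TopologicalSpace X] [GraphDist X] [TopologicalSpace Y] [GraphDist Y]

/-- `φ` maps the edge `e` onto the edge `e'` as a dilation by the factor `k`, reversing the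
parametrization if `flip = true`. -/
def DilatesOnto (M : Model X) (N : Model Y) (φ : X → Y) (k : ℕ) (e : M.E) (e' : N.E)
    (flip : Bool) : Prop :=
  N.len e' = k * M.len e ∧
  (flip = false → ∀ t ≤ M.len e, φ (M.param e t) = N.param e' (k * t)) ∧
  (flip = true → M.len e ≠ ⊤ ∧
    ∀ t ≤ M.len e, φ (M.param e t) = N.param e' (N.len e' - k * t))

/-- `φ` is a morphism with respect to the models `M` and `N`, with dilation factor `deg e` on the
edge `e`. -/
structure IsMorphism (M : Model X) (N : Model Y) (φ : X → Y) (deg : M.E → ℕ) : Prop where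
  continuous : Continuous φ
  map_vertex : ∀ v ∈ M.V, φ v ∈ N.V
  preimage_interior : ∀ e', ∃ A : Set M.E, φ ⁻¹' N.interior e' = ⋃ e ∈ A, M.interior e
  dilation : ∀ e, (deg e = 0 ∧ ∃ v ∈ N.V, ∀ t ≤ M.len e, φ (M.param e t) = v) ∨
    (0 < deg e ∧ ∃ e' flip, DilatesOnto M N φ (deg e) e e' flip)

/-- The half-edge `h` is mapped to the half-edge `h'`. -/
def MapsHalfEdge (M : Model X) (N : Model Y) (φ : X → Y) (deg : M.E → ℕ)
    (h : M.E × Bool) (h' : N.E × Bool) : Prop :=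
  0 < deg h.1 ∧ ∃ flip, DilatesOnto M N φ (deg h.1) h.1 h'.1 flip ∧ h'.2 = xor h.2 flip

open Classical in
/-- The sum of `(m'(φ(e)) / m(e)) · deg_h(φ)` over all half-edges `h` at `x` that are mapped to the
half-edge `h'`, where `e` is the edge containing `h`. -/
def degAlong (M : Model X) (N : Model Y) (φ : X → Y) (deg : M.E → ℕ)
    (m : M.E → ℕ) (m' : N.E → ℕ) (x : X) (h' : N.E × Bool) : ℕ :=
  ∑ h : M.E × Bool, if M.IsHalfEdgeAt x h ∧ MapsHalfEdge M N φ deg h h'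
    then m' h'.1 / m h.1 * deg h.1 else 0

/-- A morphism `φ` is harmonic of degree `d` with respect to the edge-multiplicities `m`, `m'`.
If the target is not a singleton, `m(e)` divides `m'(φ(e))` for all edges that are not
contracted, the number `degAlong x h'` does not depend on the half-edge `h'` at `φ(x)`, and the
sum of these local degrees over any fibre is `d`. A map from a graph that is not a
singleton to a singleton has degree zero, and a map between singletons has every degree. -/
def IsHarmonicOfDegree (M : Model X) (N : Model Y) (φ : X → Y) (deg : M.E → ℕ)
    (m : M.E → ℕ) (m' : N.E → ℕ) (d : ℕ) : Prop :=
  (Nontrivial Y ∧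
    (∀ e e' flip, 0 < deg e → DilatesOnto M N φ (deg e) e e' flip → m e ∣ m' e') ∧
    ∃ δ : X → ℕ,
      (∀ x h', N.IsHalfEdgeAt (φ x) h' → degAlong M N φ deg m m' x h' = δ x) ∧
      ∀ y, ∑ᶠ x ∈ φ ⁻¹' {y}, δ x = d) ∨
  (Subsingleton Y ∧ Nontrivial X ∧ d = 0) ∨
  (Subsingleton Y ∧ Subsingleton X)

variable (K : Type*) [Group K] [MulAction K X]

/-- `φ` is a `K`-Galois covering for some edge-multiplicities on models of its source and target:
it is a finite harmonic morphism of degree `|K|`, `K` preserves the edge-multiplicities of the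
source, and `K` acts on every fibre of `φ`, transitively. (The edge-multiplicities that are
constantly one give `K`-Galois coverings of metric graphs without multiplicities.) -/
def IsGaloisCovering (φ : X → Y) : Prop :=
  ∃ (M : Model X) (N : Model Y) (deg m : M.E → ℕ) (m' : N.E → ℕ),
    (∀ e, 0 < m e) ∧ (∀ e, 0 < m' e) ∧
    IsMorphism M N φ deg ∧ (∀ e, 0 < deg e) ∧
    IsHarmonicOfDegree M N φ deg m m' (Nat.card K) ∧
    (∀ (σ : K) (e₁ e₂ : M.E) (x : X), x ∈ M.interior e₁ → σ • x ∈ M.interior e₂ →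
      m e₁ = m e₂) ∧
    ∀ x y, φ x = φ y ↔ ∃ σ : K, σ • x = y

end Morphisms

end TropicalGraph

end

namespace TropicalGraph

open Set Filter

/-! ### Chains -/

/-! The point is that a covering induced by a generating set stretches no edge: all its dilation
factors are 1 (`Model.deg_eq_one`). In edge coordinates the map then has the form `u ↦ c ± u`, so
integer slopes pass both up and down. As the fibres are finite and are the `K`-orbits, an invariant
function descends to the image, and it is rational there exactly when it is rational on the source
(`IsMorphism.isPL_comp_iff`, `IsMorphism.image_ratFun`).

Dilation factors are tied to slopes by lattice length. Where every `F l` is affine on a piece of an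
edge, with slopes `s l` not all equal, the image is a segment in direction `s`, whose lattice length
is the length of the piece times the gcd of the differences `s l - s 0`. It suffices that this gcd
is 1. In fact two slopes of `F` are consecutive integers (`Model.exists_slope_eq_add_one`,
`Model.gcd_slopes_eq_one`). Suppose `s i + 2 ≤ s j` at a generic point. Add a constant to `F i` so
that it agrees with `F j` there; the maximum of the two has a convex kink from slope `s i` to slope
`s j`. Subtracting the truncated distance from the `K`-orbit of the point moves the slopes to `s i +
1` and `s j - 1`. This is still convex and invariant, and it stays in `R(D)^K`
(`Model.exists_mem_RDInv_of_kink`). A tropical combination of `F` can have slope `s i + 1` on an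
interval only if some `F l` has that slope there.

Rationality and divisors refer to an unspecified model, so everything must be expressed through the
distance. Edge coordinates of two models differ by translations and reflections
(`Model.exists_transition`), points at infinity are those at distance `∞` from all others
(`Model.AtInfinity.transfer`), and the order at any other point is read off from small spheres
(`Model.AffineWith.eventually_sum_sphere`). At infinity the distance does not see the topology, so
these points always need an argument of their own. -/

theorem HasChain.map {X Y : Type*} {w : X → X → ℝ≥0∞ → Prop} {w' : Y → Y → ℝ≥0∞ → Prop}
    (g : X → Y) (h : ∀ x y r, w x y r → w' (g x) (g y) r) {x y : X} {r : ℝ≥0∞}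
    (c : HasChain w x y r) : HasChain w' (g x) (g y) r := by
  induction c with
  | refl x => exact .refl _
  | step hw _ ih => exact .step (h _ _ _ hw) ih

theorem HasChain.trans {X : Type*} {w : X → X → ℝ≥0∞ → Prop} {x y z : X} {r s : ℝ≥0∞}
    (h : HasChain w x y r) (h' : HasChain w y z s) : HasChain w x z (r + s) := by
  induction h with
  | refl x => simpa using h'
  | step hw _ ih => rw [add_assoc]; exact .step hw (ih h')

theorem HasChain.single {X : Type*} {w : X → X → ℝ≥0∞ → Prop} {x y : X} {r : ℝ≥0∞}
    (h : w x y r) : HasChain w x y r := by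
  simpa using HasChain.step h (.refl y)

theorem HasChain.symm {X : Type*} {w : X → X → ℝ≥0∞ → Prop}
    (hw : ∀ x y r, w x y r → w y x r) {x y : X} {r : ℝ≥0∞}
    (h : HasChain w x y r) : HasChain w y x r := by
  induction h with
  | refl x => exact .refl _
  | step h _ ih => rw [add_comm]; exact ih.trans (.single (hw _ _ _ h))

/-- If every step of `w` is refined by a chain of `w'`, so is every chain. -/
theorem HasChain.bind {X : Type*} {w w' : X → X → ℝ≥0∞ → Prop}
    (h : ∀ x y r, w x y r → HasChain w' x y r) {x y : X} {r : ℝ≥0∞}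
    (c : HasChain w x y r) : HasChain w' x y r := by
  induction c with
  | refl x => exact .refl _
  | step hw _ ih => exact (h _ _ _ hw).trans ih

theorem chainDist_le {X : Type*} {w : X → X → ℝ≥0∞ → Prop} {x y : X} {r : ℝ≥0∞}
    (h : HasChain w x y r) : chainDist w x y ≤ r := sInf_le h

theorem exists_of_chainDist_lt {X : Type*} {w : X → X → ℝ≥0∞ → Prop} {x y : X} {r : ℝ≥0∞}
    (h : chainDist w x y < r) : ∃ s < r, HasChain w x y s := by
  obtain ⟨s, hs, hlt⟩ := sInf_lt_iff.1 h
  exact ⟨s, hlt, hs⟩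

theorem chainDist_triangle {X : Type*} (w : X → X → ℝ≥0∞ → Prop) (x y z : X) :
    chainDist w x z ≤ chainDist w x y + chainDist w y z := by
  refine ENNReal.le_of_forall_pos_le_add fun ε hε hlt => ?_
  have hε' : (ε / 2 : ℝ≥0∞) ≠ 0 := by simp [hε.ne']
  have h1 : chainDist w x y ≠ ⊤ := fun h => by simp [h] at hlt
  have h2 : chainDist w y z ≠ ⊤ := fun h => by simp [h] at hlt
  obtain ⟨r, hr, cr⟩ := exists_of_chainDist_lt (ENNReal.lt_add_right h1 hε')
  obtain ⟨s, hs, cs⟩ := exists_of_chainDist_lt (ENNReal.lt_add_right h2 hε')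
  refine (chainDist_le (cr.trans cs)).trans ((add_le_add hr.le hs.le).trans ?_)
  rw [add_add_add_comm, ENNReal.add_halves]

theorem chainDist_comm {X : Type*} {w : X → X → ℝ≥0∞ → Prop}
    (hw : ∀ x y r, w x y r → w y x r) (x y : X) : chainDist w x y = chainDist w y x :=
  le_antisymm (le_sInf fun _ h => sInf_le (HasChain.symm hw h))
    (le_sInf fun _ h => sInf_le (HasChain.symm hw h))

/-- With the discrete topology on the target, the hypothesis is continuity on `I`. -/
theorem eq_of_eventually_eq_of_isPreconnected {α : Type*} {I : Set ℝ} (hI : IsPreconnected I)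
    {g : ℝ → α} (h : ∀ u ∈ I, ∀ᶠ v in 𝓝 u, v ∈ I → g v = g u) {u v : ℝ} (hu : u ∈ I)
    (hv : v ∈ I) : g u = g v := by
  let _ : TopologicalSpace α := ⊥
  have _ : DiscreteTopology α := ⟨rfl⟩
  refine hI.constant (f := g) (fun u hu => ?_) hu hv
  rw [ContinuousWithinAt, nhds_discrete, tendsto_pure]
  exact eventually_nhdsWithin_iff.2 (h u hu)

/-! ### Edge coordinates and the path distance inside an edge -/

namespace Model

variable {X : Type*} [TopologicalSpace X] [GraphDist X] (M : Model X)

/-- The elementary steps of the path distance of a model. -/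
def Step (p q : X) (r : ℝ≥0∞) : Prop :=
  ∃ e s t, s ≤ M.len e ∧ t ≤ M.len e ∧ M.param e s = p ∧ M.param e t = q ∧
    r = (s - t) + (t - s)

theorem Step.symm {M : Model X} {p q : X} {r : ℝ≥0∞} (h : M.Step p q r) : M.Step q p r := by
  obtain ⟨e, s, t, hs, ht, hp, hq, hr⟩ := h
  exact ⟨e, t, s, ht, hs, hq, hp, by rw [hr, add_comm]⟩

theorem gdist_eq_chainDist (x y : X) : GraphDist.gdist x y = chainDist M.Step x y :=
  M.gdist_eq x y

include M in
theorem gdist_triangle (x y z : X) :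
    GraphDist.gdist x z ≤ GraphDist.gdist x y + GraphDist.gdist y z := by
  simp only [M.gdist_eq_chainDist]; exact chainDist_triangle _ _ _ _

include M in
theorem gdist_comm (x y : X) : GraphDist.gdist x y = GraphDist.gdist y x := by
  simp only [M.gdist_eq_chainDist]; exact chainDist_comm (fun _ _ _ h => h.symm) _ _

include M in
theorem gdist_self (x : X) : GraphDist.gdist x x = 0 := by
  rw [M.gdist_eq_chainDist]; exact le_antisymm (chainDist_le (.refl x)) zero_le

/-- The parametrization of an edge by real numbers. -/
noncomputable def pr (e : M.E) (t : ℝ) : X := M.param e (ENNReal.ofReal t)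

/-- `t` is the parameter of a point in the relative interior of the edge `e`. -/
def Inner (e : M.E) (t : ℝ) : Prop := 0 < t ∧ ENNReal.ofReal t < M.len e

variable {M}

theorem Inner.mem_Ioo {e : M.E} {t : ℝ} (h : M.Inner e t) :
    ENNReal.ofReal t ∈ Ioo 0 (M.len e) := ⟨ENNReal.ofReal_pos.2 h.1, h.2⟩

theorem Inner.notMem {e : M.E} {t : ℝ} (h : M.Inner e t) : M.pr e t ∉ M.V :=
  M.param_notMem e _ h.mem_Ioo

theorem Inner.of_mem_Ioo {e : M.E} {s : ℝ≥0∞} (h : s ∈ Ioo 0 (M.len e)) :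
    M.Inner e s.toReal ∧ M.pr e s.toReal = M.param e s := by
  have hs : s ≠ ⊤ := (h.2.trans_le le_top).ne
  refine ⟨⟨ENNReal.toReal_pos h.1.ne' hs, ?_⟩, ?_⟩
  · rw [ENNReal.ofReal_toReal hs]; exact h.2
  · rw [pr, ENNReal.ofReal_toReal hs]

theorem Inner.param_eq {e e' : M.E} {t : ℝ} {s : ℝ≥0∞} (h : M.Inner e t) (hs : s ≤ M.len e')
    (heq : M.param e' s = M.pr e t) : e' = e ∧ s = ENNReal.ofReal t := by
  have h0 : s ≠ 0 := by
    rintro rfl; exact h.notMem (heq ▸ M.param_zero_mem e')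
  have h1 : s ≠ M.len e' := by
    rintro rfl; exact h.notMem (heq ▸ M.param_len_mem e')
  exact M.param_inj _ _ _ _ ⟨pos_iff_ne_zero.2 h0, lt_of_le_of_ne hs h1⟩ h.mem_Ioo heq

theorem Inner.inj {e e' : M.E} {t s : ℝ} (h : M.Inner e t) (hs : M.Inner e' s)
    (heq : M.pr e' s = M.pr e t) : e' = e ∧ s = t := by
  obtain ⟨h1, h2⟩ := h.param_eq hs.2.le heq
  exact ⟨h1, (ENNReal.ofReal_eq_ofReal_iff hs.1.le h.1.le).1 h2⟩

theorem exists_inner_of_notMem (M : Model X) {x : X} (hx : x ∉ M.V) :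
    ∃ e t, M.Inner e t ∧ M.pr e t = x := by
  rcases M.cover x with h | ⟨e, t, ht, rfl⟩
  · exact absurd h hx
  · exact ⟨e, t.toReal, Inner.of_mem_Ioo ht⟩

theorem isOpen_inner (M : Model X) (e : M.E) : IsOpen {t | M.Inner e t} := by
  refine (isOpen_lt continuous_const continuous_id).inter ?_
  exact isOpen_lt ENNReal.continuous_ofReal continuous_const

theorem ordConnected_inner (M : Model X) (e : M.E) : OrdConnected {t | M.Inner e t} :=
  ⟨fun _ ha _ hb _ hc =>
    ⟨ha.1.trans_le hc.1, (ENNReal.ofReal_le_ofReal hc.2).trans_lt hb.2⟩⟩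

theorem Inner.eventually {e : M.E} {t : ℝ} (h : M.Inner e t) : ∀ᶠ u in 𝓝 t, M.Inner e u :=
  (M.isOpen_inner e).mem_nhds h

theorem ofReal_abs_sub {s t : ℝ} (hs : 0 ≤ s) (ht : 0 ≤ t) :
    ENNReal.ofReal s - ENNReal.ofReal t + (ENNReal.ofReal t - ENNReal.ofReal s) =
      ENNReal.ofReal |s - t| := by
  rw [← ENNReal.ofReal_sub _ ht, ← ENNReal.ofReal_sub _ hs]
  rcases le_total s t with h | h
  · rw [abs_of_nonpos (by linarith), ENNReal.ofReal_of_nonpos (by linarith : s - t ≤ 0)]; simp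
  · rw [abs_of_nonneg (by linarith), ENNReal.ofReal_of_nonpos (by linarith : t - s ≤ 0)]; simp

theorem gdist_param_le (M : Model X) (e : M.E) {s t : ℝ≥0∞} (hs : s ≤ M.len e)
    (ht : t ≤ M.len e) :
    GraphDist.gdist (M.param e s) (M.param e t) ≤ (s - t) + (t - s) := by
  rw [M.gdist_eq_chainDist]
  exact chainDist_le (.single ⟨e, s, t, hs, ht, rfl, rfl, rfl⟩)

theorem gdist_pr_le (M : Model X) (e : M.E) {s t : ℝ} (hs : 0 ≤ s) (ht : 0 ≤ t)
    (hs' : ENNReal.ofReal s ≤ M.len e) (ht' : ENNReal.ofReal t ≤ M.len e) :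
    GraphDist.gdist (M.pr e s) (M.pr e t) ≤ ENNReal.ofReal |s - t| := by
  rw [← ofReal_abs_sub hs ht]
  exact M.gdist_param_le e hs' ht'

/-- An interior point lies on one edge only, so a chain shorter than the distance to both ends of
the edge cannot leave it. In the induction the budget `δ` shrinks by the length of each step, which
keeps the remaining window inside the edge. -/
theorem exists_of_chain_inner {x p : X} {r : ℝ≥0∞} (c : HasChain M.Step x p r) {e : M.E} :
    ∀ {t δ : ℝ}, x = M.pr e t → r < ENNReal.ofReal δ → δ ≤ t →
      ENNReal.ofReal (t + δ) ≤ M.len e →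
      ∃ s, |s - t| < δ ∧ ENNReal.ofReal |s - t| ≤ r ∧ p = M.pr e s := by
  induction c with
  | refl x =>
    intro t δ hx hr _ _
    have : 0 < δ := ENNReal.ofReal_pos.1 (by simpa using hr)
    exact ⟨t, by simpa, by simp, hx⟩
  | @step x y z r r' hw _ ih =>
    intro t δ hx hr ht hlen
    have hδ : 0 < δ := ENNReal.ofReal_pos.1 (lt_of_le_of_lt zero_le hr)
    have hin : M.Inner e t := ⟨hδ.trans_le ht,
      ((ENNReal.ofReal_lt_ofReal_iff (by linarith)).2 (by linarith)).trans_le hlen⟩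
    obtain ⟨e', s, s', hs, hs', hp, hq, rfl⟩ := hw
    obtain ⟨rfl, rfl⟩ := hin.param_eq hs (hp.trans hx)
    have hs'top : s' ≠ ⊤ := by
      rintro rfl
      simp at hr
    obtain ⟨v, hv, rfl⟩ : ∃ v : ℝ, 0 ≤ v ∧ s' = ENNReal.ofReal v :=
      ⟨s'.toReal, ENNReal.toReal_nonneg, (ENNReal.ofReal_toReal hs'top).symm⟩
    rw [ofReal_abs_sub hin.1.le hv] at hr ⊢
    have hr'top : r' ≠ ⊤ := fun h => by simp [h] at hr
    obtain ⟨ρ, hρ, rfl⟩ : ∃ ρ : ℝ, 0 ≤ ρ ∧ r' = ENNReal.ofReal ρ :=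
      ⟨r'.toReal, ENNReal.toReal_nonneg, (ENNReal.ofReal_toReal hr'top).symm⟩
    rw [← ENNReal.ofReal_add (abs_nonneg _) hρ, ENNReal.ofReal_lt_ofReal_iff hδ] at hr
    have h1 := le_abs_self (t - v)
    have h2 := neg_abs_le (t - v)
    obtain ⟨w, hw1, hw2, hw3⟩ := ih (t := v) (δ := δ - |t - v|) hq.symm
      ((ENNReal.ofReal_lt_ofReal_iff (by linarith)).2 (by linarith)) (by linarith)
      ((ENNReal.ofReal_le_ofReal (by linarith)).trans hlen)
    have h3 : |w - t| ≤ |w - v| + |t - v| := by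
      rw [abs_sub_comm t v]; exact abs_sub_le _ _ _
    refine ⟨w, by linarith, ?_, hw3⟩
    rw [← ENNReal.ofReal_add (abs_nonneg _) hρ]
    refine ENNReal.ofReal_le_ofReal ?_
    have := (ENNReal.ofReal_le_ofReal_iff hρ).1 hw2
    linarith

theorem inner_of_abs_lt {e : M.E} {t δ s : ℝ} (ht : δ ≤ t)
    (hlen : ENNReal.ofReal (t + δ) ≤ M.len e) (hs : |s - t| < δ) : M.Inner e s := by
  obtain ⟨h1, h2⟩ := abs_lt.1 hs
  refine ⟨by linarith, lt_of_lt_of_le ?_ hlen⟩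
  exact (ENNReal.ofReal_lt_ofReal_iff (by linarith)).2 (by linarith)

/-- Near a point in the relative interior of an edge, the path distance is the distance along
that edge. -/
theorem exists_of_gdist_lt_inner {p : X} {e : M.E} {t δ : ℝ}
    (h : GraphDist.gdist (M.pr e t) p < ENNReal.ofReal δ) (ht : δ ≤ t)
    (hlen : ENNReal.ofReal (t + δ) ≤ M.len e) :
    ∃ s, |s - t| < δ ∧ p = M.pr e s ∧
      GraphDist.gdist (M.pr e t) p = ENNReal.ofReal |s - t| := by
  have h' := h
  rw [M.gdist_eq_chainDist] at h
  obtain ⟨r, hr, c⟩ := exists_of_chainDist_lt h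
  obtain ⟨s, hs, hsr, rfl⟩ := exists_of_chain_inner c rfl hr ht hlen
  have hδ : 0 < δ := ENNReal.ofReal_pos.1 (lt_of_le_of_lt zero_le hr)
  have hin := inner_of_abs_lt ht hlen hs
  have hin' : M.Inner e t := inner_of_abs_lt ht hlen (by simpa)
  refine ⟨s, hs, rfl, le_antisymm ?_ ?_⟩
  · rw [abs_sub_comm]
    exact M.gdist_pr_le e hin'.1.le hin.1.le hin'.2.le hin.2.le
  · rw [M.gdist_eq_chainDist]
    refine le_sInf fun r' c' => ?_
    rcases lt_or_ge r' (ENNReal.ofReal δ) with h1 | h1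
    · obtain ⟨s', hs', hsr', heq⟩ := exists_of_chain_inner c' rfl h1 ht hlen
      obtain ⟨-, rfl⟩ := (inner_of_abs_lt ht hlen hs').inj hin heq
      exact hsr'
    · exact (ENNReal.ofReal_le_ofReal hs.le).trans h1

theorem gdist_pr_of_abs_lt {e : M.E} {t δ s : ℝ} (ht : δ ≤ t)
    (hlen : ENNReal.ofReal (t + δ) ≤ M.len e) (hs : |s - t| < δ) :
    GraphDist.gdist (M.pr e t) (M.pr e s) = ENNReal.ofReal |s - t| := by
  have hδ : 0 < δ := (abs_nonneg _).trans_lt hs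
  have hin := inner_of_abs_lt ht hlen hs
  have hin' : M.Inner e t := inner_of_abs_lt ht hlen (by simpa)
  have hle := M.gdist_pr_le e hin'.1.le hin.1.le hin'.2.le hin.2.le
  rw [abs_sub_comm] at hle
  obtain ⟨s', hs', heq, hd⟩ := exists_of_gdist_lt_inner
    (hle.trans_lt ((ENNReal.ofReal_lt_ofReal_iff hδ).2 hs)) ht hlen
  obtain ⟨-, rfl⟩ := (inner_of_abs_lt ht hlen hs').inj hin heq
  exact hd

theorem Inner.exists_radius {e : M.E} {t : ℝ} (h : M.Inner e t) :
    ∃ δ > 0, δ ≤ t ∧ ENNReal.ofReal (t + δ) ≤ M.len e := by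
  obtain ⟨δ, hδ, hsub⟩ := Metric.eventually_nhds_iff.1 h.eventually
  refine ⟨min (δ / 2) t, lt_min (by linarith) h.1, min_le_right _ _, ?_⟩
  refine (hsub ?_).2.le
  rw [Real.dist_eq]
  have : 0 < min (δ / 2) t := lt_min (by linarith) h.1
  rw [abs_of_pos (by linarith)]
  linarith [min_le_left (δ / 2) t]

theorem Inner.eventually_gdist {e : M.E} {t : ℝ} (h : M.Inner e t) :
    ∀ᶠ s in 𝓝 t, GraphDist.gdist (M.pr e t) (M.pr e s) = ENNReal.ofReal |s - t| := by
  obtain ⟨δ, hδ, h1, h2⟩ := h.exists_radius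
  filter_upwards [Metric.ball_mem_nhds t hδ] with s hs
  exact gdist_pr_of_abs_lt h1 h2 (by simpa [Real.dist_eq] using hs)

/-- Two parametrizations of the same open arc, taken from two models, differ by a translation
and possibly a reflection. -/
theorem exists_transition (M₁ M₂ : Model X) {e₁ : M₁.E} {e₂ : M₂.E} {I : Set ℝ} (hI : IsOpen I)
    [hIc : OrdConnected I]
    (hin : ∀ u ∈ I, M₁.Inner e₁ u) (h : ∀ u ∈ I, ∃ v, M₂.Inner e₂ v ∧ M₂.pr e₂ v = M₁.pr e₁ u) :
    ∃ c : ℝ, (∀ u ∈ I, M₂.Inner e₂ (u + c) ∧ M₁.pr e₁ u = M₂.pr e₂ (u + c)) ∨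
      (∀ u ∈ I, M₂.Inner e₂ (c - u) ∧ M₁.pr e₁ u = M₂.pr e₂ (c - u)) := by
  rcases I.eq_empty_or_nonempty with rfl | ⟨u₀, hu₀⟩
  · exact ⟨0, .inl (by simp)⟩
  have h' : ∀ u, ∃ v, u ∈ I → M₂.Inner e₂ v ∧ M₂.pr e₂ v = M₁.pr e₁ u := fun u => by
    by_cases hu : u ∈ I
    · obtain ⟨v, hv⟩ := h u hu; exact ⟨v, fun _ => hv⟩
    · exact ⟨0, fun h => absurd h hu⟩
  choose τ hτ using h'
  -- Both sides are the intrinsic distance of the same two points, computed in the two models.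
  have hloc : ∀ u ∈ I, ∀ᶠ v in 𝓝 u, |τ v - τ u| = |v - u| := by
    intro u hu
    obtain ⟨δ, hδ, h1, h2⟩ := (hτ u hu).1.exists_radius
    filter_upwards [(hin u hu).eventually_gdist, hI.mem_nhds hu, Metric.ball_mem_nhds u hδ]
      with v hv hvI hvδ
    have hvδ' : |v - u| < δ := by simpa [Real.dist_eq] using hvδ
    rw [← (hτ u hu).2, ← (hτ v hvI).2] at hv
    obtain ⟨s, hs, heq, hd⟩ := exists_of_gdist_lt_inner
      (by rw [hv]; exact (ENNReal.ofReal_lt_ofReal_iff hδ).2 hvδ') h1 h2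
    obtain ⟨-, hs'⟩ := (inner_of_abs_lt h1 h2 hs).inj (hτ v hvI).1 heq
    rw [hs', ← (ENNReal.ofReal_eq_ofReal_iff (abs_nonneg _) (abs_nonneg _)), ← hd, hv]
  have hcont : ContinuousOn τ I := by
    intro u hu
    refine ContinuousAt.continuousWithinAt ?_
    rw [ContinuousAt, tendsto_iff_dist_tendsto_zero]
    have h0 : Tendsto (fun v => |v - u|) (𝓝 u) (𝓝 0) := by
      have : Continuous fun v : ℝ => |v - u| := by fun_prop
      simpa using this.tendsto u
    refine h0.congr' ?_
    filter_upwards [hloc u hu] with v hv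
    rw [Real.dist_eq, hv]
  have hinj : InjOn τ I := by
    intro u hu v hv huv
    have := (hτ u hu).2
    rw [huv, (hτ v hv).2] at this
    exact ((hin v hv).inj (hin u hu) this.symm).2
  -- Injectivity and continuity fix the orientation on all of `I`; then `τ v - v` or `τ v + v` is
  -- locally constant.
  have hmono : StrictMonoOn τ I ∨ StrictAntiOn τ I := by
    let _ : Inhabited I := ⟨⟨u₀, hu₀⟩⟩
    have := Continuous.strictMono_of_inj hcont.domRestrict hinj.injective
    exact this.imp strictMono_domRestrict.mp strictAntiOn_iff_strictAnti.mpr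
  rcases hmono with hm | hm
  · refine ⟨τ u₀ - u₀, .inl fun u hu => ?_⟩
    have := eq_of_eventually_eq_of_isPreconnected (g := fun v => τ v - v) hIc.isPreconnected
      (fun u hu => by
        filter_upwards [hloc u hu] with v hv hvI
        rcases lt_trichotomy u v with h1 | h1 | h1
        · rw [abs_of_pos (by linarith [hm hu hvI h1]), abs_of_pos (by linarith)] at hv; linarith
        · rw [h1]
        · rw [abs_of_neg (by linarith [hm hvI hu h1]), abs_of_neg (by linarith)] at hv
          linarith) hu hu₀
    have h3 : u + (τ u₀ - u₀) = τ u := by linarith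
    rw [h3]
    exact ⟨(hτ u hu).1, (hτ u hu).2.symm⟩
  · refine ⟨τ u₀ + u₀, .inr fun u hu => ?_⟩
    have := eq_of_eventually_eq_of_isPreconnected (g := fun v => τ v + v) hIc.isPreconnected
      (fun u hu => by
        filter_upwards [hloc u hu] with v hv hvI
        rcases lt_trichotomy u v with h1 | h1 | h1
        · rw [abs_of_neg (by linarith [hm hu hvI h1]), abs_of_pos (by linarith)] at hv; linarith
        · rw [h1]
        · rw [abs_of_pos (by linarith [hm hvI hu h1]), abs_of_neg (by linarith)] at hv
          linarith) hu hu₀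
    have h3 : (τ u₀ + u₀) - u = τ u := by linarith
    rw [h3]
    exact ⟨(hτ u hu).1, (hτ u hu).2.symm⟩

end Model

/-! ### Local transitions between models -/

namespace Model

variable {X : Type*} [TopologicalSpace X] [GraphDist X]

/-- `exists_transition` needs an interval that stays in a single edge of `M₂`; a small one does,
because its points are close to an interior point of `e₂` in the common distance. -/
theorem Inner.exists_local_transition {M₁ M₂ : Model X} {e₁ : M₁.E} {e₂ : M₂.E} {t₁ t₂ : ℝ}
    (h₁ : M₁.Inner e₁ t₁) (h₂ : M₂.Inner e₂ t₂) (h : M₁.pr e₁ t₁ = M₂.pr e₂ t₂) :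
    ∃ c : ℝ, (t₂ = t₁ + c ∧ ∀ᶠ u in 𝓝 t₁, M₁.pr e₁ u = M₂.pr e₂ (u + c)) ∨
      (t₂ = c - t₁ ∧ ∀ᶠ u in 𝓝 t₁, M₁.pr e₁ u = M₂.pr e₂ (c - u)) := by
  obtain ⟨δ, hδ, hd1, hd2⟩ := h₂.exists_radius
  obtain ⟨η, hη, hsub⟩ := Metric.eventually_nhds_iff_ball.1 (h₁.eventually.and
    (h₁.eventually_gdist.and (Metric.ball_mem_nhds t₁ hδ)))
  have hmem : t₁ ∈ Metric.ball t₁ η := Metric.mem_ball_self hη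
  have hoc : OrdConnected (Metric.ball t₁ η) := by
    rw [Real.ball_eq_Ioo]; exact ordConnected_Ioo
  obtain ⟨c, hc⟩ := exists_transition M₁ M₂ (e₁ := e₁) (e₂ := e₂) Metric.isOpen_ball
    (fun u hu => (hsub u hu).1) (fun u hu => by
      obtain ⟨-, hg, hb⟩ := hsub u hu
      rw [h] at hg
      obtain ⟨s, hs, heq, -⟩ := exists_of_gdist_lt_inner (δ := δ)
        (by rw [hg]; exact (ENNReal.ofReal_lt_ofReal_iff hδ).2
              (by simpa [Real.dist_eq] using hb)) hd1 hd2
      exact ⟨s, inner_of_abs_lt hd1 hd2 hs, heq.symm⟩)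
  refine ⟨c, hc.imp (fun hc => ⟨?_, ?_⟩) (fun hc => ⟨?_, ?_⟩)⟩
  · exact ((hc t₁ hmem).1.inj h₂ (h.symm.trans (hc t₁ hmem).2)).2
  · filter_upwards [Metric.ball_mem_nhds t₁ hη] with u hu using (hc u hu).2
  · exact ((hc t₁ hmem).1.inj h₂ (h.symm.trans (hc t₁ hmem).2)).2
  · filter_upwards [Metric.ball_mem_nhds t₁ hη] with u hu using (hc u hu).2

/-- Along the edge `e`, near the parameter `t`, the function `f` is affine with integer slope. -/
def LocAff (M : Model X) (f : X → EReal) (e : M.E) (t : ℝ) : Prop :=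
  ∃ (a : ℝ) (s : ℤ), ∀ᶠ u in 𝓝 t, f (M.pr e u) = ((a + s * u : ℝ) : EReal)

/-- A translation keeps the slope and a reflection negates it, so integrality does not depend on the
model. -/
theorem LocAff.transfer {M₁ M₂ : Model X} {f : X → EReal} {e₁ : M₁.E} {e₂ : M₂.E} {t₁ t₂ : ℝ}
    (hf : M₁.LocAff f e₁ t₁) (h₁ : M₁.Inner e₁ t₁) (h₂ : M₂.Inner e₂ t₂)
    (h : M₁.pr e₁ t₁ = M₂.pr e₂ t₂) : M₂.LocAff f e₂ t₂ := by
  obtain ⟨a, s, hf⟩ := hf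
  obtain ⟨c, ⟨rfl, hc⟩ | ⟨rfl, hc⟩⟩ := h₂.exists_local_transition h₁ h.symm
  · refine ⟨a + s * c, s, ?_⟩
    have : Tendsto (fun u : ℝ => u + c) (𝓝 t₂) (𝓝 (t₂ + c)) :=
      (continuous_id.add continuous_const).tendsto _
    filter_upwards [hc, this.eventually hf] with u h1 h2
    rw [h1, h2]; congr 1; ring
  · refine ⟨a + s * c, -s, ?_⟩
    have : Tendsto (fun u : ℝ => c - u) (𝓝 t₂) (𝓝 (c - t₂)) :=
      (continuous_const.sub continuous_id).tendsto _
    filter_upwards [hc, this.eventually hf] with u h1 h2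
    rw [h1, h2]; congr 1; push_cast; ring

/-! ### The topology of a metric graph and its points at infinity -/

theorem isCompact_edge (M : Model X) (e : M.E) : IsCompact (M.param e '' Icc 0 (M.len e)) :=
  isCompact_Icc.image_of_continuousOn (M.param_continuousOn e)

theorem isClosed_edge (M : Model X) (e : M.E) : IsClosed (M.param e '' Icc 0 (M.len e)) :=
  have := M.t2
  (M.isCompact_edge e).isClosed

theorem mem_or_mem_edge (M : Model X) (x : X) :
    x ∈ M.V ∨ ∃ e, x ∈ M.param e '' Icc 0 (M.len e) := by
  rcases M.cover x with h | ⟨e, t, ht, rfl⟩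
  · exact .inl h
  · exact .inr ⟨e, t, ⟨ht.1.le, ht.2.le⟩, rfl⟩

theorem compactSpace (M : Model X) : CompactSpace X := by
  refine ⟨?_⟩
  have : (univ : Set X) = ↑M.V ∪ ⋃ e, M.param e '' Icc 0 (M.len e) := by
    ext x
    simpa using M.mem_or_mem_edge x
  rw [this]
  exact M.V.finite_toSet.isCompact.union (isCompact_iUnion fun e => M.isCompact_edge e)

/-- A point on no edge would be open as well as closed, since the edges and the other vertices form
a closed set. Connectedness excludes this. -/
theorem exists_edge (M : Model X) [Nontrivial X] (x : X) :
    ∃ e, x ∈ M.param e '' Icc 0 (M.len e) := by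
  by_contra! hne
  have := M.t2
  have := M.connected
  have hcl : IsClosed ((⋃ e, M.param e '' Icc 0 (M.len e)) ∪ (↑M.V \ {x})) :=
    (isClosed_iUnion_of_finite fun e => M.isClosed_edge e).union
      (M.V.finite_toSet.subset sdiff_subset).isClosed
  have heq : ((⋃ e, M.param e '' Icc 0 (M.len e)) ∪ (↑M.V \ {x})) = ({x}ᶜ : Set X) := by
    ext y
    constructor
    · rintro (hy | hy)
      · obtain ⟨e, he⟩ := mem_iUnion.1 hy
        rintro rfl
        exact hne e he
      · exact hy.2
    · intro hy
      rcases M.mem_or_mem_edge y with h | h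
      · exact .inr ⟨h, hy⟩
      · exact .inl (mem_iUnion.2 h)
  rw [heq, isClosed_compl_iff] at hcl
  have huniv : ({x} : Set X) = univ := IsClopen.eq_univ ⟨isClosed_singleton, hcl⟩ ⟨x, rfl⟩
  obtain ⟨y, hy⟩ := exists_ne x
  exact hy (by have := mem_univ y; rwa [← huniv] at this)

theorem param_inner_ne (M : Model X) {e e' : M.E} {s t : ℝ≥0∞} (ht : t ∈ Ioo 0 (M.len e))
    (hs : s ≤ M.len e') (hne : e' ≠ e ∨ s ≠ t) : M.param e' s ≠ M.param e t := by
  intro heq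
  obtain ⟨h1, h2⟩ := Inner.of_mem_Ioo ht
  obtain ⟨h3, h4⟩ := h1.param_eq hs (heq.trans h2.symm)
  rw [ENNReal.ofReal_toReal (ht.2.trans_le le_top).ne] at h4
  exact hne.elim (absurd h3) (absurd h4)

theorem eq_top_of_param_eq (M : Model X) {e e' : M.E} {s : ℝ≥0∞} (he : M.len e = ⊤)
    (hs : s ≤ M.len e') (h : M.param e' s = M.param e ⊤) : e' = e ∧ s = ⊤ := by
  obtain ⟨h0, h1⟩ := M.infinite_leaf e he e'
  have hs0 : s ≠ 0 := by rintro rfl; exact h0 h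
  rcases hs.lt_or_eq with hlt | rfl
  · have := M.param_notMem e' s ⟨pos_iff_ne_zero.2 hs0, hlt⟩
    rw [h, ← he] at this
    exact absurd (M.param_len_mem e) this
  · obtain rfl := h1 h
    exact ⟨rfl, he⟩

/-- A point at infinity has a single edge and a single parameter, so the step of a chain that leaves
it has infinite length. -/
theorem AtInfinity.gdist_eq_top {M : Model X} {x y : X} (h : M.AtInfinity x) (hy : y ≠ x) :
    GraphDist.gdist x y = ⊤ := by
  obtain ⟨e, he, hx⟩ := h
  rw [M.gdist_eq_chainDist, chainDist, sInf_eq_top]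
  intro r hr
  have key : ∀ p q r, HasChain M.Step p q r → p = x → q = y → r = ⊤ := by
    intro p q r c
    induction c with
    | refl q => intro h h'; exact absurd (h'.symm.trans h) hy
    | step hw _ ih =>
      rintro rfl hqy
      obtain ⟨e', s, t, hs, ht, hp, hq, rfl⟩ := hw
      obtain ⟨rfl, rfl⟩ := M.eq_top_of_param_eq he hs (hp.trans hx.symm)
      rcases eq_or_ne t ⊤ with rfl | ht
      · rw [ih (hq.symm.trans hx) hqy, add_top]
      · simp [ENNReal.top_sub ht]
  exact key x y r hr rfl rfl

theorem AtInfinity.nontrivial {M : Model X} {x : X} (h : M.AtInfinity x) : Nontrivial X := by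
  obtain ⟨e, he, -⟩ := h
  exact ⟨_, _, (M.infinite_leaf e he e).1⟩

/-- A point with a finite parameter has finite distance to other points of its edge. With
`AtInfinity.gdist_eq_top` this characterizes points at infinity by distance alone, hence
independently of the model and compatibly with isometries. -/
theorem atInfinity_of_gdist_eq_top (M : Model X) [Nontrivial X] {x : X}
    (h : ∀ y ≠ x, GraphDist.gdist x y = ⊤) : M.AtInfinity x := by
  obtain ⟨e, s, hs, rfl⟩ := M.exists_edge x
  rcases eq_or_ne s ⊤ with rfl | hs'
  · exact ⟨e, top_le_iff.1 hs.2, rfl⟩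
  · obtain ⟨t, ht, hts⟩ : ∃ t ∈ Ioo 0 (M.len e), t ≠ s := by
      obtain ⟨a, ha, hae⟩ := exists_between (M.len_pos e)
      obtain ⟨b, hb, hba⟩ := exists_between ha
      rcases eq_or_ne a s with rfl | hne
      · exact ⟨b, ⟨hb, hba.trans hae⟩, hba.ne⟩
      · exact ⟨a, ⟨ha, hae⟩, hne⟩
    have h1 := h _ (M.param_inner_ne ht hs.2 (.inr hts.symm)).symm
    have h2 := M.gdist_param_le e hs.2 ht.2.le
    rw [h1, top_le_iff, ENNReal.add_eq_top] at h2
    have ht' : t ≠ ⊤ := (ht.2.trans_le le_top).ne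
    rcases h2 with h2 | h2
    · exact absurd h2 (ENNReal.sub_ne_top hs')
    · exact absurd h2 (ENNReal.sub_ne_top ht')

theorem AtInfinity.transfer {M₁ : Model X} (M₂ : Model X) {x : X} (h : M₁.AtInfinity x) :
    M₂.AtInfinity x :=
  have := h.nontrivial
  M₂.atInfinity_of_gdist_eq_top fun _ hy => h.gdist_eq_top hy

theorem tendsto_pr_top (M : Model X) {e : M.E} (he : M.len e = ⊤) :
    Tendsto (M.pr e) atTop (𝓝 (M.param e ⊤)) := by
  have hc := M.param_continuousOn e
  rw [he, ← bot_eq_zero', Icc_bot_top, continuousOn_univ] at hc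
  exact (hc.tendsto ⊤).comp ENNReal.tendsto_ofReal_atTop

/-- Two parametrizations of the ray that ends at a given point at infinity differ by a
translation. -/
theorem exists_transition_top (M₁ M₂ : Model X) {e₁ : M₁.E} {e₂ : M₂.E} (h₁ : M₁.len e₁ = ⊤)
    (h₂ : M₂.len e₂ = ⊤) (h : M₁.param e₁ ⊤ = M₂.param e₂ ⊤) :
    ∃ c : ℝ, ∀ᶠ u in atTop, M₁.pr e₁ u = M₂.pr e₂ (u + c) := by
  have := M₂.t2
  -- The complement of this set is a neighbourhood of the end point that meets neither other edges
  -- nor other vertices; the ray of `M₁` eventually stays in it.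
  have hcl : IsClosed ((⋃ e ∈ {e | e ≠ e₂}, M₂.param e '' Icc 0 (M₂.len e)) ∪
      (↑M₂.V \ {M₂.param e₂ ⊤})) :=
    ((toFinite {e | e ≠ e₂}).isClosed_biUnion fun e _ => M₂.isClosed_edge e).union
      (M₂.V.finite_toSet.subset sdiff_subset).isClosed
  have hx : M₂.param e₂ ⊤ ∉ ((⋃ e ∈ {e | e ≠ e₂}, M₂.param e '' Icc 0 (M₂.len e)) ∪
      (↑M₂.V \ {M₂.param e₂ ⊤})) := by
    rintro (hx | hx)
    · simp only [mem_iUnion] at hx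
      obtain ⟨e, hne, s, hs, heq⟩ := hx
      exact hne (M₂.eq_top_of_param_eq h₂ hs.2 heq).1
    · exact hx.2 rfl
  have htop := M₁.tendsto_pr_top h₁
  rw [h] at htop
  have hev := htop.eventually (hcl.isOpen_compl.mem_nhds hx)
  obtain ⟨U, hU⟩ := eventually_atTop.1 (hev.and (eventually_gt_atTop 0))
  have hin : ∀ u ∈ Ioi U, M₁.Inner e₁ u := fun u hu =>
    ⟨(hU u (le_of_lt hu)).2, h₁ ▸ ENNReal.ofReal_lt_top⟩
  obtain ⟨c, hc | hc⟩ := exists_transition M₁ M₂ (e₁ := e₁) (e₂ := e₂) isOpen_Ioi hin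
    (fun u hu => by
      have hu' := (hU u (le_of_lt hu)).1
      simp only [mem_union, not_or, mem_iUnion] at hu'
      have hne : M₁.pr e₁ u ≠ M₂.param e₂ ⊤ := by
        rw [← h]
        exact (M₁.param_inner_ne (hin u hu).mem_Ioo (by rw [h₁])
          (.inr ENNReal.ofReal_ne_top.symm)).symm
      have hV : M₁.pr e₁ u ∉ M₂.V := fun hV => hu'.2 ⟨hV, hne⟩
      obtain ⟨e, v, hv, heq⟩ := M₂.exists_inner_of_notMem hV
      have : e = e₂ := by
        by_contra hne'
        exact hu'.1 ⟨e, hne', _, ⟨zero_le, hv.2.le⟩, heq⟩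
      subst this
      exact ⟨v, hv, heq⟩)
  · exact ⟨c, (eventually_gt_atTop U).mono fun u hu => (hc u hu).2⟩
  -- A reflection would produce a nonpositive parameter as soon as `u ≥ c`.
  · have := (hc (max (U + 1) c) (lt_of_lt_of_le (lt_add_one U) (le_max_left _ _))).1.1
    linarith [le_max_right (U + 1) c]

end Model

/-! ### Subdivision of models -/

namespace Model

variable {X : Type*} [TopologicalSpace X] [GraphDist X]

section Subdivision

variable (M : Model X) (e₀ : M.E) (t₀ : ℝ≥0∞)

/-- The edge of a model that contains a given edge of its subdivision at the point of `e₀` with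
parameter `t₀`: `none` stands for the part of `e₀` beyond `t₀`, and `some e₀` for the part up to
`t₀`. -/
def subBase (x : Option M.E) : M.E := x.getD e₀

/-- The parameter at which an edge of the subdivision starts. -/
noncomputable def subStart (x : Option M.E) : ℝ≥0∞ := if x = none then t₀ else 0

open Classical in
/-- The lengths of the edges of the subdivision. -/
noncomputable def subLen (x : Option M.E) : ℝ≥0∞ :=
  x.elim (M.len e₀ - t₀) fun e => if e = e₀ then t₀ else M.len e

/-- The elementary steps along the edges of the subdivision. -/
def SubStep (p q : X) (r : ℝ≥0∞) : Prop :=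
  ∃ (x : Option M.E) (s t : ℝ≥0∞), s ≤ M.subLen e₀ t₀ x ∧ t ≤ M.subLen e₀ t₀ x ∧
    M.param (M.subBase e₀ x) (M.subStart t₀ x + s) = p ∧
    M.param (M.subBase e₀ x) (M.subStart t₀ x + t) = q ∧ r = (s - t) + (t - s)

variable {M e₀ t₀}

theorem subStart_ne_top (ht : t₀ ∈ Ioo 0 (M.len e₀)) (x : Option M.E) :
    M.subStart t₀ x ≠ ⊤ := by
  unfold subStart
  split_ifs
  · exact (ht.2.trans_le le_top).ne
  · simp

theorem subLen_pos (ht : t₀ ∈ Ioo 0 (M.len e₀)) (x : Option M.E) : 0 < M.subLen e₀ t₀ x := by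
  rcases x with _ | e
  · exact tsub_pos_of_lt ht.2
  · simp only [subLen, Option.elim]
    split_ifs
    · exact ht.1
    · exact M.len_pos e

theorem subStart_cases (ht : t₀ ∈ Ioo 0 (M.len e₀)) (x : Option M.E) :
    (M.subStart t₀ x = 0 ∧
      ((M.subBase e₀ x = e₀ ∧ M.subStart t₀ x + M.subLen e₀ t₀ x = t₀) ∨
        (M.subBase e₀ x ≠ e₀ ∧ M.subStart t₀ x + M.subLen e₀ t₀ x = M.len (M.subBase e₀ x)))) ∨
    (x = none ∧ M.subBase e₀ x = e₀ ∧ M.subStart t₀ x = t₀ ∧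
        M.subStart t₀ x + M.subLen e₀ t₀ x = M.len e₀) := by
  rcases x with _ | e
  · right
    simp [subStart, subLen, subBase, add_tsub_cancel_of_le ht.2.le]
  · left
    by_cases he : e = e₀ <;> simp [subStart, subLen, subBase, he]

theorem subStart_add_subLen_le (ht : t₀ ∈ Ioo 0 (M.len e₀)) (x : Option M.E) :
    M.subStart t₀ x + M.subLen e₀ t₀ x ≤ M.len (M.subBase e₀ x) := by
  rcases subStart_cases ht x with ⟨-, ⟨h1, h2⟩ | ⟨-, h2⟩⟩ | ⟨-, h1, -, h2⟩
  · rw [h2, h1]; exact ht.2.le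
  · rw [h2]
  · rw [h2, h1]

theorem subStart_add_mem_Ioo (ht : t₀ ∈ Ioo 0 (M.len e₀)) {x : Option M.E} {s : ℝ≥0∞}
    (hs : s ∈ Ioo 0 (M.subLen e₀ t₀ x)) :
    M.subStart t₀ x + s ∈ Ioo 0 (M.len (M.subBase e₀ x)) :=
  ⟨hs.1.trans_le le_add_self,
    ((ENNReal.add_lt_add_iff_left (subStart_ne_top ht x)).2 hs.2).trans_le
      (subStart_add_subLen_le ht x)⟩

theorem subBase_injOn (ht : t₀ ∈ Ioo 0 (M.len e₀)) {x y : Option M.E} {s t : ℝ≥0∞}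
    (hs : s ∈ Ioo 0 (M.subLen e₀ t₀ x)) (ht' : t ∈ Ioo 0 (M.subLen e₀ t₀ y))
    (hb : M.subBase e₀ x = M.subBase e₀ y) (hst : M.subStart t₀ x + s = M.subStart t₀ y + t) :
    x = y := by
  have ht0 : t₀ ≠ ⊤ := (ht.2.trans_le le_top).ne
  rcases x with _ | e <;> rcases y with _ | e'
  · rfl
  · simp only [subBase, Option.getD] at hb
    subst hb
    simp only [subStart, subLen, Option.elim, if_pos, reduceCtorEq, if_false, zero_add] at *
    have := hs.1
    have h3 : t₀ < t₀ + s := ENNReal.lt_add_right ht0 this.ne'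
    rw [hst] at h3
    exact absurd ht'.2 h3.not_gt
  · simp only [subBase, Option.getD] at hb
    subst hb
    simp only [subStart, subLen, Option.elim, if_pos, reduceCtorEq, if_false, zero_add] at *
    have := ht'.1
    have h3 : t₀ < t₀ + t := ENNReal.lt_add_right ht0 this.ne'
    rw [← hst] at h3
    exact absurd hs.2 h3.not_gt
  · simpa [subBase] using hb

/-- A step along `e₀` that crosses `t₀` is cut there into two steps whose lengths add up to the
original one; hence subdividing does not change the distance. -/
theorem subStep_chain (ht : t₀ ∈ Ioo 0 (M.len e₀)) {p q : X} {r : ℝ≥0∞} (h : M.Step p q r) :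
    HasChain (M.SubStep e₀ t₀) p q r := by
  have ht0 : t₀ ≠ ⊤ := (ht.2.trans_le le_top).ne
  obtain ⟨e, s, t, hs, ht', rfl, rfl, rfl⟩ := h
  by_cases he : e = e₀
  · subst he
    have low : ∀ s t, s ≤ t₀ → t ≤ t₀ → HasChain (M.SubStep e t₀) (M.param e s) (M.param e t) (s - t + (t - s)) :=
      fun s t hs ht => .single ⟨some e, s, t, by simpa [subLen] using hs,
        by simpa [subLen] using ht, by simp [subStart, subBase], by simp [subStart, subBase], rfl⟩
    have high : ∀ s t, t₀ ≤ s → t₀ ≤ t → s ≤ M.len e → t ≤ M.len e →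
        HasChain (M.SubStep e t₀) (M.param e s) (M.param e t) (s - t + (t - s)) :=
      fun s t hs ht hs' ht' => .single ⟨none, s - t₀, t - t₀,
        tsub_le_tsub_right hs' _, tsub_le_tsub_right ht' _,
        by simp [subStart, subBase, add_tsub_cancel_of_le hs],
        by simp [subStart, subBase, add_tsub_cancel_of_le ht],
        by rw [← ENNReal.add_sub_add_eq_sub_left ht0 (b := s - t₀),
          ← ENNReal.add_sub_add_eq_sub_left ht0 (b := t - t₀),
          add_tsub_cancel_of_le hs, add_tsub_cancel_of_le ht]⟩
    rcases le_total s t₀ with h1 | h1 <;> rcases le_total t t₀ with h2 | h2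
    · exact low s t h1 h2
    · have := (low s t₀ h1 le_rfl).trans (high t₀ t le_rfl h2 ht.2.le ht')
      rw [tsub_eq_zero_of_le h1, tsub_eq_zero_of_le h2, zero_add, zero_add, add_comm,
        tsub_add_tsub_cancel h2 h1] at this
      rwa [tsub_eq_zero_of_le (h1.trans h2), zero_add]
    · have := (high s t₀ h1 le_rfl hs ht.2.le).trans (low t₀ t le_rfl h2)
      rw [tsub_eq_zero_of_le h1, tsub_eq_zero_of_le h2, add_zero, add_zero,
        tsub_add_tsub_cancel h1 h2] at this
      rwa [tsub_eq_zero_of_le (h2.trans h1), add_zero]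
    · exact high s t h1 h2 hs ht'
  · exact .single ⟨some e, s, t, by simpa [subLen, he] using hs,
      by simpa [subLen, he] using ht', by simp [subStart, subBase],
      by simp [subStart, subBase], rfl⟩

open Classical in
/-- The subdivision of the edge `e₀` at the point with parameter `t₀`. -/
noncomputable def subdivide (M : Model X) (e₀ : M.E) (t₀ : ℝ≥0∞) (ht : t₀ ∈ Ioo 0 (M.len e₀)) :
    Model X where
  t2 := M.t2
  connected := M.connected
  V := insert (M.param e₀ t₀) M.V
  E := Option M.E
  fintypeE := inferInstance
  len := M.subLen e₀ t₀
  len_pos := subLen_pos ht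
  param x t := M.param (M.subBase e₀ x) (M.subStart t₀ x + t)
  param_continuousOn x := by
    refine (M.param_continuousOn _).comp (continuous_const.add continuous_id).continuousOn ?_
    intro s hs
    exact ⟨zero_le, (add_le_add le_rfl hs.2).trans (subStart_add_subLen_le ht x)⟩
  param_zero_mem x := by
    rw [add_zero, Finset.mem_insert]
    rcases subStart_cases ht x with ⟨h, -⟩ | ⟨-, h, h', -⟩
    · rw [h]; exact .inr (M.param_zero_mem _)
    · rw [h, h']; exact .inl rfl
  param_len_mem x := by
    rw [Finset.mem_insert]
    rcases subStart_cases ht x with ⟨-, ⟨h1, h2⟩ | ⟨-, h2⟩⟩ | ⟨-, h1, -, h2⟩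
    · rw [h2, h1]; exact .inl rfl
    · rw [h2]; exact .inr (M.param_len_mem _)
    · rw [h2, h1]; exact .inr (M.param_len_mem _)
  param_notMem x s hs := by
    rw [Finset.mem_insert, not_or]
    refine ⟨?_, M.param_notMem _ _ (subStart_add_mem_Ioo ht hs)⟩
    refine M.param_inner_ne ht (subStart_add_mem_Ioo ht hs).2.le ?_
    by_contra! hcon
    rcases subStart_cases ht x with ⟨h, ⟨-, h2⟩ | ⟨h1, -⟩⟩ | ⟨-, -, h, -⟩
    · have := (ENNReal.add_lt_add_iff_left (subStart_ne_top ht x)).2 hs.2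
      rw [h2, hcon.2] at this
      exact this.false
    · exact h1 hcon.1
    · have := ENNReal.lt_add_right (subStart_ne_top ht x) hs.1.ne'
      rw [hcon.2, h] at this
      exact this.false
  param_inj x y s t hs ht' h := by
    obtain ⟨h1, h2⟩ := M.param_inj _ _ _ _ (subStart_add_mem_Ioo ht hs)
      (subStart_add_mem_Ioo ht ht') h
    obtain rfl := subBase_injOn ht hs ht' h1 h2
    exact ⟨rfl, (ENNReal.add_right_inj (subStart_ne_top ht x)).1 h2⟩
  cover p := by
    rw [Finset.mem_insert]
    have ht0 : t₀ ≠ ⊤ := (ht.2.trans_le le_top).ne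
    rcases M.cover p with h | ⟨e, s, hs, rfl⟩
    · exact .inl (.inr h)
    · by_cases he : e = e₀
      · subst he
        rcases lt_trichotomy s t₀ with h | rfl | h
        · exact .inr ⟨some e, s, ⟨hs.1, by simpa [subLen] using h⟩,
            by simp [subStart, subBase]⟩
        · exact .inl (.inl rfl)
        · refine .inr ⟨none, s - t₀, ⟨tsub_pos_of_lt h, ?_⟩, ?_⟩
          · rw [← ENNReal.add_lt_add_iff_left ht0, add_tsub_cancel_of_le h.le]
            simpa [subLen, add_tsub_cancel_of_le ht.2.le] using hs.2
          · simp [subStart, subBase, add_tsub_cancel_of_le h.le]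
      · exact .inr ⟨some e, s, ⟨hs.1, by simpa [subLen, he] using hs.2⟩,
          by simp [subStart, subBase]⟩
  infinite_leaf x hx y := by
    have hb : M.len (M.subBase e₀ x) = ⊤ := by
      have := subStart_add_subLen_le ht x
      rwa [hx, add_top, top_le_iff] at this
    rw [add_top, add_zero]
    refine ⟨fun h => ?_, fun h => ?_⟩
    · refine subStart_ne_top ht y (M.eq_top_of_param_eq hb ?_ h).2
      exact le_self_add.trans (subStart_add_subLen_le ht y)
    · obtain ⟨h1, h2⟩ := M.eq_top_of_param_eq hb (subStart_add_subLen_le ht y) h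
      have hy : M.subLen e₀ t₀ y = ⊤ := by
        by_contra hne
        exact ENNReal.add_ne_top.2 ⟨subStart_ne_top ht y, hne⟩ h2
      have ht0 : t₀ ≠ ⊤ := (ht.2.trans_le le_top).ne
      -- Both parts lie in the same old edge; since `t₀` is finite, only the half beyond it can have
      -- infinite length.
      rcases x with _ | e <;> rcases y with _ | e'
      · rfl
      · simp only [subBase, Option.getD] at h1
        subst h1
        exact absurd (by simpa [subLen] using hy) ht0
      · simp only [subBase, Option.getD] at h1
        subst h1
        exact absurd (by simpa [subLen] using hx) ht0
      · simpa [subBase] using h1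
  gdist_eq p q := by
    rw [M.gdist_eq_chainDist]
    refine le_antisymm (le_sInf fun r hr => sInf_le ?_) (le_sInf fun r hr => sInf_le ?_)
    · refine HasChain.map id (fun p q r h => ?_) hr
      obtain ⟨x, s, t, hs, ht', hp, hq, rfl⟩ := h
      refine ⟨_, _, _, (add_le_add le_rfl hs).trans (subStart_add_subLen_le ht x),
        (add_le_add le_rfl ht').trans (subStart_add_subLen_le ht x), hp, hq, ?_⟩
      rw [ENNReal.add_sub_add_eq_sub_left (subStart_ne_top ht x),
        ENNReal.add_sub_add_eq_sub_left (subStart_ne_top ht x)]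
    · exact HasChain.bind (fun _ _ _ h => subStep_chain ht h) hr

end Subdivision

/-- Every finite set of points is contained in the vertex set of some model. -/
theorem exists_subset_vertices (M : Model X) (S : Finset X) : ∃ M' : Model X, S ⊆ M'.V := by
  classical
  induction S using Finset.induction_on with
  | empty => exact ⟨M, by simp⟩
  | insert p S hp ih =>
    obtain ⟨M', hM'⟩ := ih
    rcases M'.cover p with h | ⟨e, t, ht, rfl⟩
    · exact ⟨M', Finset.insert_subset h hM'⟩
    · exact ⟨M'.subdivide e t ht, Finset.insert_subset (Finset.mem_insert_self _ _)
        (hM'.trans (Finset.subset_insert _ _))⟩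

end Model

/-! ### Affine and piecewise linear functions -/

theorem affine_coeff_unique {u a b : ℝ} {s s' : ℤ} {l : Filter ℝ} (hl : l ≤ 𝓝[≠] u) [l.NeBot]
    (h : ∀ᶠ v in l, a + s * v = b + s' * v) (hu : a + s * u = b + s' * u) : a = b ∧ s = s' := by
  obtain ⟨v, hv, hne⟩ := (h.and (hl self_mem_nhdsWithin)).exists
  have h1 : ((s : ℝ) - s') * (v - u) = 0 := by linear_combination hv - hu
  have h2 : (s : ℝ) - s' = 0 := (mul_eq_zero.1 h1).resolve_right (sub_ne_zero.2 hne)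
  have h3 : s = s' := by exact_mod_cast sub_eq_zero.1 h2
  subst h3
  exact ⟨by linarith, rfl⟩

theorem affine_coeff_unique' {u a b : ℝ} {s s' : ℤ}
    (h : ∀ᶠ v in 𝓝 u, a + s * v = b + s' * v) : a = b ∧ s = s' :=
  affine_coeff_unique le_rfl (h.filter_mono nhdsWithin_le_nhds) h.self_of_nhds

/-- Slope 0 is separate because multiplication on `EReal` is not continuous at `(0, ∞)`; the product
with the constant slope 0 is nevertheless constant. The sum causes no trouble since `a` is finite.
-/
theorem continuous_affine_ennreal (a : ℝ) (s : ℤ) :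
    Continuous fun t : ℝ≥0∞ => (a : EReal) + (((s : ℤ) : ℝ) : EReal) * (t : EReal) := by
  rw [continuous_iff_continuousAt]
  intro t
  have h1 : ContinuousAt (fun t : ℝ≥0∞ => (((s : ℤ) : ℝ) : EReal) * (t : EReal)) t := by
    rcases eq_or_ne s 0 with rfl | hs
    · simpa using continuousAt_const
    · have hs' : (((s : ℤ) : ℝ) : EReal) ≠ 0 := by
        exact_mod_cast hs
      have h2 : ContinuousAt (fun p : EReal × EReal => p.1 * p.2)
          ((((s : ℤ) : ℝ) : EReal), (t : EReal)) :=
        EReal.continuousAt_mul (.inl hs') (.inl hs') (.inl (EReal.coe_ne_bot _))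
          (.inl (EReal.coe_ne_top _))
      exact ContinuousAt.comp (f := fun t : ℝ≥0∞ => ((((s : ℤ) : ℝ) : EReal), (t : EReal))) h2
        (continuousAt_const.prodMk continuous_coe_ennreal_ereal.continuousAt)
  have h2 : ContinuousAt (fun p : EReal × EReal => p.1 + p.2)
      ((a : EReal), (((s : ℤ) : ℝ) : EReal) * (t : EReal)) :=
    EReal.continuousAt_add (.inl (EReal.coe_ne_top _)) (.inl (EReal.coe_ne_bot _))
  exact ContinuousAt.comp
    (f := fun t : ℝ≥0∞ => ((a : EReal), (((s : ℤ) : ℝ) : EReal) * (t : EReal))) h2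
    (continuousAt_const.prodMk h1)

namespace Model

variable {X : Type*} [TopologicalSpace X] [GraphDist X]

/-- The preimage of a closed set is a finite set of vertices together with finitely many compact
images of closed parts of the edges. -/
theorem continuous_of_continuousOn_edges (M : Model X) {Z : Type*} [TopologicalSpace Z] {f : X → Z}
    (h : ∀ e, ContinuousOn (fun t => f (M.param e t)) (Icc 0 (M.len e))) : Continuous f := by
  have := M.t2
  rw [continuous_iff_isClosed]
  intro C hC
  have heq : f ⁻¹' C = (↑M.V ∩ f ⁻¹' C) ∪
      ⋃ e, M.param e '' (Icc 0 (M.len e) ∩ (fun t => f (M.param e t)) ⁻¹' C) := by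
    ext x
    constructor
    · intro hx
      rcases M.mem_or_mem_edge x with h | ⟨e, t, ht, rfl⟩
      · exact .inl ⟨h, hx⟩
      · exact .inr (mem_iUnion.2 ⟨e, t, ⟨ht, hx⟩, rfl⟩)
    · rintro (hx | hx)
      · exact hx.2
      · obtain ⟨e, t, ht, rfl⟩ := mem_iUnion.1 hx
        exact ht.2
  rw [heq]
  refine (M.V.finite_toSet.subset inter_subset_left).isClosed.union
    (isClosed_iUnion_of_finite fun e => ?_)
  have hcl := (h e).preimage_isClosed_of_isClosed isClosed_Icc hC
  exact (IsCompact.image_of_continuousOn (hcl.isCompact)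
    ((M.param_continuousOn e).mono inter_subset_left)).isClosed

theorem AffineWith.eq_pr {M : Model X} {f : X → EReal} {s : M.E → ℤ} (h : M.AffineWith f s)
    (e : M.E) : ∃ a : ℝ, (∀ t : ℝ, 0 ≤ t → ENNReal.ofReal t ≤ M.len e →
      f (M.pr e t) = ((a + s e * t : ℝ) : EReal)) := by
  obtain ⟨a, ha⟩ := h.1 e
  refine ⟨a, fun t ht hle => ?_⟩
  rw [pr, ha _ hle, EReal.coe_ennreal_ofReal, max_eq_left ht]
  push_cast
  rfl

theorem AffineWith.continuous {M : Model X} {f : X → EReal} {s : M.E → ℤ}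
    (h : M.AffineWith f s) : Continuous f := by
  refine M.continuous_of_continuousOn_edges fun e => ?_
  obtain ⟨a, ha⟩ := h.1 e
  exact (continuous_affine_ennreal a (s e)).continuousOn.congr fun t ht => ha t ht.2

theorem AffineWith.locAff {M : Model X} {f : X → EReal} {s : M.E → ℤ}
    (h : M.AffineWith f s) {e : M.E} {t : ℝ} (ht : M.Inner e t) : M.LocAff f e t := by
  obtain ⟨a, ha⟩ := h.eq_pr e
  exact ⟨a, s e, ht.eventually.mono fun u hu => ha u hu.1.le hu.2.le⟩

/-- The pair of intercept and slope is locally constant on the connected interior of an edge, hence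
constant; continuity carries the formula to the ends, including a parameter `∞`. -/
theorem exists_affineWith_of_locAff (M : Model X) {f : X → EReal} (hc : Continuous f)
    (hfin : ∀ x, f x = ⊤ ∨ f x = ⊥ → M.AtInfinity x)
    (hloc : ∀ e t, M.Inner e t → M.LocAff f e t) : ∃ s, M.AffineWith f s := by
  have key : ∀ e, ∃ s : ℤ, ∃ a : ℝ, ∀ t ≤ M.len e,
      f (M.param e t) = (a : EReal) + (((s : ℤ) : ℝ) : EReal) * (t : EReal) := by
    intro e
    have h' : ∀ t, ∃ p : ℝ × ℤ, M.Inner e t →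
        ∀ᶠ u in 𝓝 t, f (M.pr e u) = ((p.1 + p.2 * u : ℝ) : EReal) := fun t => by
      by_cases ht : M.Inner e t
      · obtain ⟨a, s, h⟩ := hloc e t ht
        exact ⟨(a, s), fun _ => h⟩
      · exact ⟨(0, 0), fun h => absurd h ht⟩
    choose p hp using h'
    have hconst : ∀ u v, M.Inner e u → M.Inner e v → p u = p v := fun u v hu hv =>
      eq_of_eventually_eq_of_isPreconnected (M.ordConnected_inner e).isPreconnected
        (fun u hu => by
          filter_upwards [(hp u hu).eventually_nhds] with v hv hvI
          have := affine_coeff_unique' (u := v) (a := (p v).1) (s := (p v).2) (b := (p u).1)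
            (s' := (p u).2) (by
              filter_upwards [hv, hp v hvI] with w h1 h2
              rw [h1] at h2
              exact_mod_cast h2.symm)
          exact Prod.ext this.1 this.2) hu hv
    obtain ⟨r₀, hr₀⟩ := exists_between (M.len_pos e)
    obtain ⟨hin₀, -⟩ := Inner.of_mem_Ioo hr₀
    refine ⟨(p r₀.toReal).2, (p r₀.toReal).1, fun t ht => ?_⟩
    refine Set.EqOn.of_subset_closure (s := Ioo 0 (M.len e)) (t := Icc 0 (M.len e))
      (f := fun t => f (M.param e t)) ?_
      (hc.comp_continuousOn (M.param_continuousOn e)) (continuous_affine_ennreal _ _).continuousOn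
      Ioo_subset_Icc_self (by rw [closure_Ioo (M.len_pos e).ne]) ⟨zero_le, ht⟩
    intro t ht
    obtain ⟨h1, h2⟩ := Inner.of_mem_Ioo ht
    have h3 := (hp _ h1).self_of_nhds
    rw [hconst _ _ h1 hin₀, h2] at h3
    simp only []
    rw [h3]
    have : (t : EReal) = ((t.toReal : ℝ) : EReal) := by
      conv_lhs => rw [← ENNReal.ofReal_toReal (ht.2.trans_le le_top).ne]
      rw [EReal.coe_ennreal_ofReal, max_eq_left ENNReal.toReal_nonneg]
    rw [this]
    push_cast
    rfl
  choose s hs using key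
  exact ⟨s, hs, hfin⟩

/-- `f` is continuous, takes infinite values only at infinity, and is locally affine with integer
slopes away from a finite set. -/
def IsPL (M : Model X) (f : X → EReal) : Prop :=
  Continuous f ∧ (∀ x, f x = ⊤ ∨ f x = ⊥ → M.AtInfinity x) ∧
    ∃ S : Set X, S.Finite ∧ ∀ e t, M.Inner e t → M.pr e t ∉ S → M.LocAff f e t

theorem AffineWith.isPL {M' : Model X} {f : X → EReal} {s : M'.E → ℤ} (h : M'.AffineWith f s)
    (M : Model X) : M.IsPL f := by
  refine ⟨h.continuous, fun x hx => (h.2 x hx).transfer M, M'.V, M'.V.finite_toSet,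
    fun e t ht hV => ?_⟩
  obtain ⟨e', t', ht', heq⟩ := M'.exists_inner_of_notMem hV
  exact (h.locAff ht').transfer ht' ht heq

/-- It is enough that the vertices contain the exceptional points and the vertices of `M`. Allowing
every such `M'` makes it possible to treat two functions on one common model. -/
theorem IsPL.exists_affineWith {M : Model X} {f : X → EReal} (h : M.IsPL f) :
    ∃ S : Finset X, ∀ M' : Model X, S ⊆ M'.V → ∃ s, M'.AffineWith f s := by
  classical
  obtain ⟨hc, hfin, S, hS, hloc⟩ := h
  refine ⟨hS.toFinset ∪ M.V, fun M' hM' => M'.exists_affineWith_of_locAff hc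
    (fun x hx => (hfin x hx).transfer M') fun e t ht => ?_⟩
  have hn : M'.pr e t ∉ hS.toFinset ∪ M.V := fun h => ht.notMem (hM' h)
  rw [Finset.mem_union, not_or, hS.mem_toFinset] at hn
  obtain ⟨e', t', ht', heq⟩ := M.exists_inner_of_notMem hn.2
  exact (hloc e' t' ht' (heq ▸ hn.1)).transfer ht' ht heq

theorem IsPL.exists_affineWith' {M : Model X} {f : X → EReal} (h : M.IsPL f) :
    ∃ (M' : Model X) (s : M'.E → ℤ), M'.AffineWith f s := by
  obtain ⟨S, hS⟩ := h.exists_affineWith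
  obtain ⟨M', hM'⟩ := M.exists_subset_vertices S
  exact ⟨M', hS M' hM'⟩

/-- Replaces the existential model in `RatFun` by a criterion in any fixed one. -/
theorem mem_ratFun_iff (M : Model X) {f : X → EReal} :
    f ∈ RatFun X ↔ (∀ x, f x = ⊥) ∨ M.IsPL f :=
  or_congr_right ⟨fun ⟨_, _, h⟩ => h.isPL M, fun h => h.exists_affineWith'⟩

end Model

namespace Model

variable {X : Type*} [TopologicalSpace X] [GraphDist X] {M : Model X}

/-! ### Small spheres and the order of a rational function at a point -/

/-- The sphere of radius `r` about `x`. -/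
def _root_.TropicalGraph.gsphere (x : X) (r : ℝ) : Set X :=
  {y | GraphDist.gdist x y = ENNReal.ofReal r}

theorem sphere_inner {e : M.E} {t δ r : ℝ} (ht : δ ≤ t)
    (hlen : ENNReal.ofReal (t + δ) ≤ M.len e) (hr : 0 < r) (hrδ : r < δ) :
    gsphere (M.pr e t) r = {M.pr e (t - r), M.pr e (t + r)} := by
  have hδ := hr.trans hrδ
  ext y
  change _ = _ ↔ _ ∨ _
  constructor
  · intro (hy : GraphDist.gdist _ _ = _)
    obtain ⟨s, hs, rfl, hd⟩ := exists_of_gdist_lt_inner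
      (hy ▸ (ENNReal.ofReal_lt_ofReal_iff hδ).2 hrδ) ht hlen
    rw [hy, ENNReal.ofReal_eq_ofReal_iff hr.le (abs_nonneg _)] at hd
    rcases abs_choice (s - t) with h | h
    · right; congr 1; linarith
    · left; congr 1; linarith
  · rintro (rfl | rfl)
    · have h : |t - r - t| = r := by rw [sub_sub_cancel_left, abs_neg, abs_of_pos hr]
      rw [gdist_pr_of_abs_lt ht hlen (by rw [h]; exact hrδ), h]
    · have h : |t + r - t| = r := by rw [add_sub_cancel_left, abs_of_pos hr]
      rw [gdist_pr_of_abs_lt ht hlen (by rw [h]; exact hrδ), h]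

theorem sphere_inner_ne {e : M.E} {t δ r : ℝ} (ht : δ ≤ t)
    (hlen : ENNReal.ofReal (t + δ) ≤ M.len e) (hr : 0 < r) (hrδ : r < δ) :
    M.pr e (t - r) ≠ M.pr e (t + r) := by
  intro h
  have h1 : M.Inner e (t - r) := inner_of_abs_lt ht hlen
    (by rw [sub_sub_cancel_left, abs_neg, abs_of_pos hr]; exact hrδ)
  have h2 : M.Inner e (t + r) := inner_of_abs_lt ht hlen
    (by rw [add_sub_cancel_left, abs_of_pos hr]; exact hrδ)
  have := (h2.inj h1 h).2
  linarith

variable (M) in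
/-- The half-edge `h` starts at the vertex `x`. -/
def StartsAt (x : X) (h : M.E × Bool) : Prop :=
  (h.2 = true ∧ M.param h.1 0 = x) ∨ (h.2 = false ∧ M.param h.1 (M.len h.1) = x)

variable (M) in
/-- The parameter of the point of the half-edge `h` at distance `r` from its start. -/
noncomputable def germ (h : M.E × Bool) (r : ℝ) : ℝ :=
  if h.2 = true then r else (M.len h.1).toReal - r

theorem StartsAt.len_ne_top {x : X} (hx : ¬ M.AtInfinity x) {e : M.E}
    (h : M.StartsAt x (e, false)) : M.len e ≠ ⊤ := by
  intro he
  rcases h with h | h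
  · exact absurd h.1 (by simp)
  · exact hx ⟨e, he, by have := h.2; simp only [he] at this; exact this⟩

theorem StartsAt.pr_germ_zero {x : X} (hx : ¬ M.AtInfinity x) {h : M.E × Bool}
    (hh : M.StartsAt x h) : M.pr h.1 (M.germ h 0) = x := by
  obtain ⟨e, b⟩ := h
  cases b
  · have := hh.len_ne_top hx
    simp only [germ, pr, Bool.false_eq_true, if_false, sub_zero, ENNReal.ofReal_toReal this]
    rcases hh with h | h
    · exact absurd h.1 (by simp)
    · exact h.2
  · simp only [germ, pr, if_true, ENNReal.ofReal_zero]
    rcases hh with h | h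
    · exact h.2
    · exact absurd h.1 (by simp)

theorem StartsAt.inner_germ {x : X} (hx : ¬ M.AtInfinity x) {h : M.E × Bool}
    (hh : M.StartsAt x h) {δ r : ℝ} (hδ : ENNReal.ofReal (2 * δ) ≤ M.len h.1) (hr : 0 < r)
    (hrδ : r < δ) : M.Inner h.1 (M.germ h r) := by
  obtain ⟨e, b⟩ := h
  cases b
  · have hl := hh.len_ne_top hx
    have h1 := (ENNReal.ofReal_le_iff_le_toReal hl).1 hδ
    simp only [germ, Bool.false_eq_true, if_false]
    refine ⟨by linarith, ?_⟩
    rw [ENNReal.ofReal_lt_iff_lt_toReal (by linarith) hl]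
    linarith
  · simp only [germ, if_true]
    refine ⟨hr, lt_of_lt_of_le ?_ hδ⟩
    exact (ENNReal.ofReal_lt_ofReal_iff (by linarith)).2 (by linarith)

/-- The bound `2 * δ ≤ len` keeps the germs at the two ends of one edge apart, which matters when a
loop meets `x` with both ends. -/
theorem StartsAt.germ_inj {x : X} (hx : ¬ M.AtInfinity x) {h h' : M.E × Bool}
    (hh : M.StartsAt x h) (hh' : M.StartsAt x h') {δ r r' : ℝ}
    (hδ : ∀ e, ENNReal.ofReal (2 * δ) ≤ M.len e) (hr : 0 < r)
    (hrδ : r < δ) (hr' : 0 < r') (hrδ' : r' < δ)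
    (heq : M.pr h.1 (M.germ h r) = M.pr h'.1 (M.germ h' r')) : h = h' ∧ r = r' := by
  obtain ⟨h1, h2⟩ := (hh'.inner_germ hx (hδ _) hr' hrδ').inj (hh.inner_germ hx (hδ _) hr hrδ) heq
  obtain ⟨e, b⟩ := h
  obtain ⟨e', b'⟩ := h'
  simp only at h1
  subst h1
  cases b <;> cases b' <;> simp only [germ, Bool.false_eq_true, if_false, if_true] at h2
  · exact ⟨rfl, by linarith⟩
  · have h3 := (ENNReal.ofReal_le_iff_le_toReal (hh.len_ne_top hx)).1 (hδ e)
    linarith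
  · have h3 := (ENNReal.ofReal_le_iff_le_toReal (hh'.len_ne_top hx)).1 (hδ e)
    linarith
  · exact ⟨rfl, h2⟩

/-- A chain of length less than `δ` from `x` stays in the star formed by the half-edges at `x`. The
induction tracks the radius `ρ` in that star: a step raises it by at most its length, and only
through `x` can the half-edge change. -/
theorem exists_of_chain_vertex {x : X} (hx : ¬ M.AtInfinity x) (hxV : x ∈ M.V) {δ : ℝ}
    (hδ : ∀ e, ENNReal.ofReal (2 * δ) ≤ M.len e) {p q : X} {R : ℝ≥0∞}
    (c : HasChain M.Step p q R) :
    ∀ {ρ : ℝ}, 0 ≤ ρ → ENNReal.ofReal ρ + R < ENNReal.ofReal δ →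
      (p = x ∨ (0 < ρ ∧ ∃ h, M.StartsAt x h ∧ p = M.pr h.1 (M.germ h ρ))) →
      ∃ ρ', 0 ≤ ρ' ∧ ENNReal.ofReal ρ' ≤ ENNReal.ofReal ρ + R ∧
        (q = x ∨ (0 < ρ' ∧ ∃ h, M.StartsAt x h ∧ q = M.pr h.1 (M.germ h ρ'))) := by
  induction c with
  | refl p => exact fun {ρ} hρ _ hp => ⟨ρ, hρ, by simp, hp⟩
  | @step p z q r r' hw _ ih =>
    intro ρ hρ hlt hp
    have hδ0 : 0 < δ := ENNReal.ofReal_pos.1 (lt_of_le_of_lt zero_le hlt)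
    rw [← add_assoc] at hlt ⊢
    have hlt1 : ENNReal.ofReal ρ + r < ENNReal.ofReal δ := lt_of_le_of_lt le_self_add hlt
    suffices hz : ∃ ρ', 0 ≤ ρ' ∧ ENNReal.ofReal ρ' ≤ ENNReal.ofReal ρ + r ∧
        (z = x ∨ (0 < ρ' ∧ ∃ h, M.StartsAt x h ∧ z = M.pr h.1 (M.germ h ρ'))) by
      obtain ⟨ρ', h0, h1, h2⟩ := hz
      obtain ⟨ρ'', h3, h4, h5⟩ := ih h0 ((add_le_add h1 le_rfl).trans_lt hlt) h2
      exact ⟨ρ'', h3, h4.trans (add_le_add h1 le_rfl), h5⟩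
    have hrt : r ≠ ⊤ := fun h => by simp [h] at hlt1
    obtain ⟨e, s, s', hs, hs', hp', rfl, hreq⟩ := hw
    rcases hp with rfl | ⟨hρ0, h, hh, rfl⟩
    · have hcase : s = 0 ∨ s = M.len e := by
        by_contra! hcon
        exact M.param_notMem e s ⟨pos_iff_ne_zero.2 hcon.1, lt_of_le_of_ne hs hcon.2⟩ (hp' ▸ hxV)
      rcases hcase with rfl | rfl
      · rw [zero_tsub, zero_add, tsub_zero] at hreq
        subst hreq
        refine ⟨r.toReal, ENNReal.toReal_nonneg, ?_, ?_⟩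
        · rw [ENNReal.ofReal_toReal hrt]; exact le_add_self
        · rcases eq_or_ne r 0 with rfl | hr0
          · exact .inl hp'
          · refine .inr ⟨ENNReal.toReal_pos hr0 hrt, (e, true), .inl ⟨rfl, hp'⟩, ?_⟩
            simp [germ, pr, ENNReal.ofReal_toReal hrt]
      · have hst : M.StartsAt p (e, false) := .inr ⟨rfl, hp'⟩
        have hl := hst.len_ne_top hx
        rw [tsub_eq_zero_of_le hs', add_zero] at hreq
        refine ⟨r.toReal, ENNReal.toReal_nonneg, ?_, ?_⟩
        · rw [ENNReal.ofReal_toReal hrt]; exact le_add_self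
        · have hs'' : s' = M.len e - r := by
            rw [hreq, ENNReal.sub_sub_cancel hl hs']
          rcases eq_or_ne r 0 with rfl | hr0
          · left; rw [hs'', tsub_zero]; exact hp'
          · refine .inr ⟨ENNReal.toReal_pos hr0 hrt, (e, false), hst, ?_⟩
            simp only [germ, pr, Bool.false_eq_true, if_false]
            rw [hs'', ← ENNReal.toReal_sub_of_le (hreq ▸ tsub_le_self) hl,
              ENNReal.ofReal_toReal (ENNReal.sub_ne_top hl)]
    · have hρδ : ρ < δ := (ENNReal.ofReal_lt_ofReal_iff hδ0).1 (lt_of_le_of_lt le_self_add hlt1)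
      have hin := hh.inner_germ hx (hδ _) hρ0 hρδ
      obtain ⟨rfl, rfl⟩ := hin.param_eq hs hp'
      have hs't : s' ≠ ⊤ := by
        rintro rfl
        exact hrt (by rw [hreq, ENNReal.top_sub ENNReal.ofReal_ne_top, add_top])
      obtain ⟨v, hv, rfl⟩ : ∃ v : ℝ, 0 ≤ v ∧ s' = ENNReal.ofReal v :=
        ⟨s'.toReal, ENNReal.toReal_nonneg, (ENNReal.ofReal_toReal hs't).symm⟩
      rw [ofReal_abs_sub hin.1.le hv] at hreq
      subst hreq
      have h1 := le_abs_self (M.germ h ρ - v)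
      have h2 := neg_abs_le (M.germ h ρ - v)
      obtain ⟨ρ', hρ', hle, hg⟩ : ∃ ρ', 0 ≤ ρ' ∧ ρ' ≤ ρ + |M.germ h ρ - v| ∧ v = M.germ h ρ' := by
        obtain ⟨e, b⟩ := h
        cases b
        · have hl := hh.len_ne_top hx
          simp only [germ, Bool.false_eq_true, if_false] at h1 h2 ⊢
          refine ⟨(M.len e).toReal - v, ?_, by linarith, by ring⟩
          have := (ENNReal.ofReal_le_iff_le_toReal hl).1 hs'
          linarith
        · simp only [germ, if_true] at h1 h2 ⊢
          exact ⟨v, hv, by linarith, rfl⟩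
      refine ⟨ρ', hρ', ?_, ?_⟩
      · rw [← ENNReal.ofReal_add hρ (abs_nonneg _)]
        exact ENNReal.ofReal_le_ofReal hle
      · rcases hρ'.eq_or_lt with rfl | hpos
        · left
          rw [hg]
          exact hh.pr_germ_zero hx
        · exact .inr ⟨hpos, h, hh, by rw [hg]; rfl⟩

theorem StartsAt.gdist_eq {x : X} (hx : ¬ M.AtInfinity x) (hxV : x ∈ M.V) {δ : ℝ}
    (hδ : ∀ e, ENNReal.ofReal (2 * δ) ≤ M.len e) {h : M.E × Bool} (hh : M.StartsAt x h) {r : ℝ}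
    (hr : 0 < r) (hrδ : r < δ) :
    GraphDist.gdist x (M.pr h.1 (M.germ h r)) = ENNReal.ofReal r := by
  have hin := hh.inner_germ hx (hδ _) hr hrδ
  have hδ0 := hr.trans hrδ
  refine le_antisymm ?_ ?_
  · have h0 : 0 ≤ M.germ h 0 ∧ ENNReal.ofReal (M.germ h 0) ≤ M.len h.1 := by
      obtain ⟨e, b⟩ := h
      cases b
      · simp [germ, ENNReal.ofReal_toReal (hh.len_ne_top hx)]
      · simp [germ]
    have := M.gdist_pr_le h.1 h0.1 hin.1.le h0.2 hin.2.le
    rw [hh.pr_germ_zero hx] at this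
    refine this.trans_eq ?_
    congr 1
    obtain ⟨e, b⟩ := h
    cases b <;> simp [germ, abs_of_pos hr]
  · rw [M.gdist_eq_chainDist]
    refine le_sInf fun R hR => ?_
    by_contra! hlt
    have hltδ : ENNReal.ofReal 0 + R < ENNReal.ofReal δ := by
      simpa using hlt.trans ((ENNReal.ofReal_lt_ofReal_iff hδ0).2 hrδ)
    obtain ⟨ρ, hρ, hle, hcase⟩ := exists_of_chain_vertex hx hxV hδ hR le_rfl hltδ (.inl rfl)
    rw [ENNReal.ofReal_zero, zero_add] at hle
    have hρr : ρ < r := (ENNReal.ofReal_lt_ofReal_iff hr).1 (hle.trans_lt hlt)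
    rcases hcase with hcase | ⟨hρ0, h', hh', heq⟩
    · exact hin.notMem (hcase ▸ hxV)
    · exact hρr.ne (hh.germ_inj hx hh' hδ hr hrδ hρ0 (hρr.trans hrδ) heq).2.symm

/-- Each half-edge at `x` contributes exactly one point, so a sum over the sphere is a sum over
outgoing directions; this makes the order computable from the distance. -/
theorem sphere_vertex {x : X} (hx : ¬ M.AtInfinity x) (hxV : x ∈ M.V) {δ : ℝ}
    (hδ : ∀ e, ENNReal.ofReal (2 * δ) ≤ M.len e) {r : ℝ} (hr : 0 < r) (hrδ : r < δ) :
    gsphere x r =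
      (fun h : M.E × Bool => M.pr h.1 (M.germ h r)) '' {h | M.StartsAt x h} := by
  have hδ0 := hr.trans hrδ
  ext y
  constructor
  · intro (hy : GraphDist.gdist x y = ENNReal.ofReal r)
    have hlt : GraphDist.gdist x y < ENNReal.ofReal δ := by
      rw [hy]; exact (ENNReal.ofReal_lt_ofReal_iff hδ0).2 hrδ
    rw [M.gdist_eq_chainDist] at hlt
    obtain ⟨R, hR, c⟩ := exists_of_chainDist_lt hlt
    obtain ⟨ρ, hρ, hle, hcase⟩ := exists_of_chain_vertex hx hxV hδ c le_rfl
      (by simpa using hR) (.inl rfl)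
    rw [ENNReal.ofReal_zero, zero_add] at hle
    rcases hcase with rfl | ⟨hρ0, h, hh, rfl⟩
    · rw [M.gdist_self, eq_comm, ENNReal.ofReal_eq_zero] at hy
      linarith
    · have hρδ : ρ < δ := (ENNReal.ofReal_lt_ofReal_iff hδ0).1 (hle.trans_lt hR)
      have := hh.gdist_eq hx hxV hδ hρ0 hρδ
      rw [hy, ENNReal.ofReal_eq_ofReal_iff hr.le hρ] at this
      exact ⟨h, hh, by rw [this]⟩
  · rintro ⟨h, hh, rfl⟩
    exact hh.gdist_eq hx hxV hδ hr hrδ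

theorem exists_pos_le_len (M : Model X) : ∃ δ > 0, ∀ e, ENNReal.ofReal (2 * δ) ≤ M.len e := by
  have h : ∀ e, ∃ δ : ℝ, 0 < δ ∧ ENNReal.ofReal (2 * δ) ≤ M.len e := fun e => by
    obtain ⟨r, hr0, hr⟩ := exists_between (M.len_pos e)
    have hrt : r ≠ ⊤ := (hr.trans_le le_top).ne
    refine ⟨r.toReal / 2, by have := ENNReal.toReal_pos hr0.ne' hrt; linarith, ?_⟩
    rw [mul_div_cancel₀ _ (two_ne_zero), ENNReal.ofReal_toReal hrt]
    exact hr.le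
  choose g hg0 hg using h
  rcases isEmpty_or_nonempty M.E with hE | hE
  · exact ⟨1, one_pos, fun e => hE.elim e⟩
  · obtain ⟨e₀, he₀⟩ := Finite.exists_min g
    exact ⟨g e₀, hg0 e₀, fun e =>
      (ENNReal.ofReal_le_ofReal (by linarith [he₀ e])).trans (hg e)⟩

open Classical in
theorem ord_eq_sum_startsAt (M : Model X) (s : M.E → ℤ) (x : X) :
    M.ord s x = ∑ h ∈ Finset.univ.filter (M.StartsAt x), if h.2 = true then s h.1 else - s h.1 := by
  rw [Finset.sum_filter, Fintype.sum_prod_type, ord]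
  refine Finset.sum_congr rfl fun e _ => ?_
  rw [Fintype.sum_bool]
  simp only [StartsAt, true_and, Bool.true_eq_false, false_and, or_false, if_true,
    Bool.false_eq_true, false_or, if_false]
  split_ifs <;> ring

theorem ord_eq_zero_of_notMem (M : Model X) (s : M.E → ℤ) {x : X} (hx : x ∉ M.V) :
    M.ord s x = 0 := by
  refine Finset.sum_eq_zero fun e _ => ?_
  rw [if_neg (fun h : _ = x => hx (h ▸ M.param_zero_mem e)),
    if_neg (fun h : _ = x => hx (h ▸ M.param_len_mem e)), sub_zero]

theorem ord_of_infinite (M : Model X) (s : M.E → ℤ) {e : M.E} (he : M.len e = ⊤) :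
    M.ord s (M.param e ⊤) = - s e := by
  rw [ord, Finset.sum_eq_single e]
  · rw [if_neg (M.infinite_leaf e he e).1, he, if_pos rfl, zero_sub]
  · intro e' _ hne
    rw [if_neg (M.infinite_leaf e he e').1, if_neg fun h => hne ((M.infinite_leaf e he e').2 h),
      sub_zero]
  · simp

/-- At a point that is not at infinity, the order of a rational function is read off from its
values on small spheres. -/
theorem AffineWith.eventually_sum_sphere {f : X → EReal} {s : M.E → ℤ} (hf : M.AffineWith f s)
    {x : X} (hx : ¬ M.AtInfinity x) :
    ∀ᶠ r in 𝓝[>] (0 : ℝ), (gsphere x r).Finite ∧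
      ∑ᶠ y ∈ gsphere x r, ((f y).toReal - (f x).toReal) =
        r * M.ord s x := by
  classical
  by_cases hxV : x ∈ M.V
  · obtain ⟨δ, hδ0, hδ⟩ := M.exists_pos_le_len
    filter_upwards [Ioo_mem_nhdsGT hδ0] with r hr
    rw [sphere_vertex hx hxV hδ hr.1 hr.2]
    refine ⟨(toFinite _).image _, ?_⟩
    have hinj : InjOn (fun h : M.E × Bool => M.pr h.1 (M.germ h r)) {h | M.StartsAt x h} :=
      fun h hh h' hh' heq => (StartsAt.germ_inj hx hh hh' hδ hr.1 hr.2 hr.1 hr.2 heq).1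
    rw [finsum_mem_image hinj]
    have hcoe : {h | M.StartsAt x h} = ↑(Finset.univ.filter (M.StartsAt x)) := by
      ext; simp
    rw [hcoe, finsum_mem_coe_finset, ord_eq_sum_startsAt]
    push_cast
    rw [Finset.mul_sum]
    refine Finset.sum_congr rfl fun h hh => ?_
    have hh : M.StartsAt x h := by simpa using hh
    obtain ⟨a, ha⟩ := hf.eq_pr h.1
    have hin := hh.inner_germ hx (hδ _) hr.1 hr.2
    have h0 : 0 ≤ M.germ h 0 ∧ ENNReal.ofReal (M.germ h 0) ≤ M.len h.1 := by
      obtain ⟨e, b⟩ := h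
      cases b
      · simp [germ, ENNReal.ofReal_toReal (hh.len_ne_top hx)]
      · simp [germ]
    have h1 := ha _ h0.1 h0.2
    rw [hh.pr_germ_zero hx] at h1
    rw [ha _ hin.1.le hin.2.le, h1, EReal.toReal_coe, EReal.toReal_coe]
    simp only [germ]
    split_ifs <;> ring
  · obtain ⟨e, t, ht, rfl⟩ := M.exists_inner_of_notMem hxV
    obtain ⟨δ, hδ0, h1, h2⟩ := ht.exists_radius
    filter_upwards [Ioo_mem_nhdsGT hδ0] with r hr
    rw [sphere_inner h1 h2 hr.1 hr.2]
    refine ⟨toFinite _, ?_⟩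
    rw [finsum_mem_pair (sphere_inner_ne h1 h2 hr.1 hr.2), M.ord_eq_zero_of_notMem _ hxV]
    obtain ⟨a, ha⟩ := hf.eq_pr e
    have hi1 : M.Inner e (t - r) := inner_of_abs_lt h1 h2
      (by rw [sub_sub_cancel_left, abs_neg, abs_of_pos hr.1]; exact hr.2)
    have hi2 : M.Inner e (t + r) := inner_of_abs_lt h1 h2
      (by rw [add_sub_cancel_left, abs_of_pos hr.1]; exact hr.2)
    rw [ha _ ht.1.le ht.2.le, ha _ hi1.1.le hi1.2.le, ha _ hi2.1.le hi2.2.le]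
    simp only [EReal.toReal_coe]
    push_cast
    ring

end Model

namespace Model

variable {X : Type*} [TopologicalSpace X] [GraphDist X] {M : Model X}

/-! ### Operations on piecewise linear functions -/

theorem continuous_add_coe {Z : Type*} [TopologicalSpace Z] {f : Z → EReal} (hf : Continuous f)
    {g : Z → ℝ} (hg : Continuous g) : Continuous fun x => f x + (g x : EReal) := by
  rw [continuous_iff_continuousAt]
  intro x
  have h2 : ContinuousAt (fun p : EReal × EReal => p.1 + p.2) (f x, (g x : EReal)) :=
    EReal.continuousAt_add (.inr (EReal.coe_ne_bot _)) (.inr (EReal.coe_ne_top _))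
  exact ContinuousAt.comp (f := fun x => (f x, (g x : EReal))) h2
    (hf.continuousAt.prodMk (continuous_coe_real_ereal.comp hg).continuousAt)

theorem IsPL.exists_real {f : X → EReal} (hf : M.IsPL f) {x : X} (hx : ¬ M.AtInfinity x) :
    ∃ r : ℝ, f x = r := by
  have h1 : f x ≠ ⊤ := fun h => hx (hf.2.1 x (.inl h))
  have h2 : f x ≠ ⊥ := fun h => hx (hf.2.1 x (.inr h))
  exact ⟨(f x).toReal, (EReal.coe_toReal h1 h2).symm⟩

theorem IsPL.change {f : X → EReal} {M' : Model X} (hf : M'.IsPL f) (M : Model X) : M.IsPL f := by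
  obtain ⟨M'', s, h⟩ := hf.exists_affineWith'
  exact h.isPL M

theorem IsPL.add_const {f : X → EReal} (hf : M.IsPL f) (c : ℝ) : M.IsPL fun x => f x + c := by
  obtain ⟨hc, hfin, S, hS, hloc⟩ := hf
  refine ⟨continuous_add_coe hc continuous_const, fun x hx => hfin x ?_, S, hS,
    fun e t ht hp => ?_⟩
  · change f x + c = ⊤ ∨ f x + c = ⊥ at hx
    generalize f x = y at hx ⊢
    induction y with
    | bot => exact .inr rfl
    | coe r =>
      rw [← EReal.coe_add] at hx
      exact (hx.elim (EReal.coe_ne_top _) (EReal.coe_ne_bot _)).elim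
    | top => exact .inl rfl
  · obtain ⟨a, s, h⟩ := hloc e t ht hp
    refine ⟨a + c, s, h.mono fun u hu => ?_⟩
    change f _ + _ = _
    rw [hu, ← EReal.coe_add]; congr 1; ring

theorem LocAff.max_of_lt {f g : X → EReal} {e : M.E} {t a b : ℝ} {s s' : ℤ}
    (hf : ∀ᶠ u in 𝓝 t, f (M.pr e u) = ((a + s * u : ℝ) : EReal))
    (hg : ∀ᶠ u in 𝓝 t, g (M.pr e u) = ((b + s' * u : ℝ) : EReal))
    (h : a + s * t < b + s' * t) : M.LocAff (fun x => max (f x) (g x)) e t := by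
  have hev : ∀ᶠ u in 𝓝 t, a + s * u < b + s' * u :=
    (isOpen_lt (f := fun u : ℝ => a + s * u) (g := fun u : ℝ => b + s' * u)
      (by fun_prop) (by fun_prop)).mem_nhds h
  refine ⟨b, s', ?_⟩
  filter_upwards [hf, hg, hev] with u h1 h2 h3
  rw [h1, h2, max_eq_right (EReal.coe_le_coe_iff.2 h3.le)]

/-- On a common model the only new break points are crossings, and two affine functions of different
slopes cross at most once on an edge. -/
theorem IsPL.max {f g : X → EReal} (hf : M.IsPL f) (hg : M.IsPL g) :
    M.IsPL fun x => max (f x) (g x) := by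
  classical
  obtain ⟨S₁, h₁⟩ := hf.exists_affineWith
  obtain ⟨S₂, h₂⟩ := hg.exists_affineWith
  obtain ⟨M', hM'⟩ := M.exists_subset_vertices (S₁ ∪ S₂)
  obtain ⟨s, hs⟩ := h₁ M' (Finset.subset_union_left.trans hM')
  obtain ⟨s', hs'⟩ := h₂ M' (Finset.subset_union_right.trans hM')
  refine IsPL.change (M' := M') ⟨hf.1.max hg.1, fun x hx => ?_, ?_⟩ M
  · rcases max_choice (f x) (g x) with h | h
    · exact hs.2 x (by rwa [h] at hx)
    · exact hs'.2 x (by rwa [h] at hx)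
  · choose a ha using hs.eq_pr
    choose b hb using hs'.eq_pr
    refine ⟨⋃ e, M'.pr e '' {u | s e ≠ s' e ∧ a e + s e * u = b e + s' e * u},
      finite_iUnion fun e => Set.Finite.image _ (Set.Subsingleton.finite ?_), fun e t ht hp => ?_⟩
    · rintro u ⟨hne, hu⟩ v ⟨-, hv⟩
      by_contra huv
      have h1 : ((s e : ℝ) - s' e) * (u - v) = 0 := by linear_combination hu - hv
      have h2 : (s e : ℝ) - s' e = 0 := (mul_eq_zero.1 h1).resolve_right (sub_ne_zero.2 huv)
      exact hne (by exact_mod_cast sub_eq_zero.1 h2)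
    · have hfe : ∀ᶠ u in 𝓝 t, f (M'.pr e u) = ((a e + s e * u : ℝ) : EReal) :=
        ht.eventually.mono fun u hu => ha e u hu.1.le hu.2.le
      have hge : ∀ᶠ u in 𝓝 t, g (M'.pr e u) = ((b e + s' e * u : ℝ) : EReal) :=
        ht.eventually.mono fun u hu => hb e u hu.1.le hu.2.le
      rcases lt_trichotomy (a e + s e * t) (b e + s' e * t) with h | h | h
      · exact LocAff.max_of_lt hfe hge h
      · have hss : s e = s' e := by
          by_contra hne
          exact hp (mem_iUnion.2 ⟨e, t, ⟨hne, h⟩, rfl⟩)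
        rw [hss] at h hfe
        have hab : a e = b e := by linarith
        rw [hab] at hfe
        refine ⟨b e, s' e, ?_⟩
        filter_upwards [hfe, hge] with u h1 h2
        rw [h1, h2, max_self]
      · simp_rw [max_comm (f _)]
        exact LocAff.max_of_lt hge hfe h

/-! ### Isometric actions -/

theorem AtInfinity.mem_V {x : X} (h : M.AtInfinity x) : x ∈ M.V := by
  obtain ⟨e, he, rfl⟩ := h
  rw [← he]
  exact M.param_len_mem e

variable {K : Type*} [Group K] [MulAction K X]

theorem gdist_smul_left (hK : IsIsometricAction K X) (σ : K) (x y : X) :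
    GraphDist.gdist (σ • x) y = GraphDist.gdist x (σ⁻¹ • y) := by
  rw [← (hK σ).2 x (σ⁻¹ • y), smul_inv_smul]

theorem AtInfinity.of_smul (hK : IsIsometricAction K X) {σ : K} {x : X}
    (h : M.AtInfinity (σ • x)) : M.AtInfinity x := by
  have := h.nontrivial
  refine M.atInfinity_of_gdist_eq_top fun y hy => ?_
  rw [← (hK σ).2]
  exact h.gdist_eq_top fun h => hy (MulAction.injective σ h)

theorem gsphere_smul (hK : IsIsometricAction K X) (σ : K) (x : X) (r : ℝ) :
    gsphere (σ • x) r = (fun y => σ • y) '' gsphere x r := by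
  ext y
  constructor
  · intro (hy : GraphDist.gdist _ _ = _)
    exact ⟨σ⁻¹ • y, by rw [gdist_smul_left hK] at hy; exact hy, smul_inv_smul σ y⟩
  · rintro ⟨y, hy, rfl⟩
    exact ((hK σ).2 x y).trans hy

open Classical in
/-- The image of a model under an isometry. -/
noncomputable def smul (M : Model X) (hK : IsIsometricAction K X) (σ : K) : Model X where
  t2 := M.t2
  connected := M.connected
  V := M.V.image (σ • ·)
  E := M.E
  fintypeE := M.fintypeE
  len := M.len
  len_pos := M.len_pos
  param e t := σ • M.param e t
  param_continuousOn e := (hK σ).1.comp_continuousOn (M.param_continuousOn e)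
  param_zero_mem e := Finset.mem_image_of_mem _ (M.param_zero_mem e)
  param_len_mem e := Finset.mem_image_of_mem _ (M.param_len_mem e)
  param_notMem e t ht h := by
    obtain ⟨v, hv, heq⟩ := Finset.mem_image.1 h
    exact M.param_notMem e t ht (MulAction.injective σ heq ▸ hv)
  param_inj e e' s t hs ht h := M.param_inj e e' s t hs ht (MulAction.injective σ h)
  cover x := by
    rcases M.cover (σ⁻¹ • x) with h | ⟨e, t, ht, h⟩
    · exact .inl (Finset.mem_image.2 ⟨_, h, smul_inv_smul σ x⟩)
    · exact .inr ⟨e, t, ht, by rw [h, smul_inv_smul]⟩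
  infinite_leaf e he e' := by
    obtain ⟨h1, h2⟩ := M.infinite_leaf e he e'
    exact ⟨fun h => h1 (MulAction.injective σ h), fun h => h2 (MulAction.injective σ h)⟩
  gdist_eq x y := by
    rw [← smul_inv_smul σ x, ← smul_inv_smul σ y, (hK σ).2, M.gdist_eq_chainDist]
    refine le_antisymm (le_sInf fun r hr => sInf_le ?_) (le_sInf fun r hr => sInf_le ?_)
    · have := HasChain.map (w' := M.Step) (fun z => σ⁻¹ • z) ?_ hr
      · simpa using this
      · rintro p q r ⟨e, s, t, hs, ht, rfl, rfl, rfl⟩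
        exact ⟨e, s, t, hs, ht, by simp, by simp, rfl⟩
    · refine HasChain.map (fun z => σ • z) ?_ hr
      rintro p q r ⟨e, s, t, hs, ht, rfl, rfl, rfl⟩
      exact ⟨e, s, t, hs, ht, rfl, rfl, rfl⟩

/-- In the translated model `M.smul hK σ` the point `σ • M.pr e t` has the parameter `t` on `e`, and
an invariant function has the same formula there. -/
theorem LocAff.of_smul (hK : IsIsometricAction K X) {f : X → EReal} (hf : IsInvariantFun K f)
    {e e' : M.E} {t t' : ℝ} {σ : K} (h : M.LocAff f e t) (ht : M.Inner e t) (ht' : M.Inner e' t')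
    (heq : M.pr e' t' = σ • M.pr e t) : M.LocAff f e' t' := by
  have h' : (M.smul hK σ).LocAff f e t := by
    obtain ⟨a, s, h⟩ := h
    refine ⟨a, s, h.mono fun u hu => ?_⟩
    rw [← hu]
    exact hf σ _
  exact h'.transfer (M₁ := M.smul hK σ) ht ht' heq.symm

/-! ### The truncated distance from an orbit -/

section Tent

variable (K)

/-- The distance from the orbit of `x₀`, truncated at `ε`. -/
noncomputable def tent (x₀ : X) (ε : ℝ) (y : X) : ℝ :=
  (min (ENNReal.ofReal ε) (⨅ σ : K, GraphDist.gdist y (σ • x₀))).toReal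

variable {K} {x₀ : X} {ε : ℝ}

theorem ofReal_tent (y : X) : ENNReal.ofReal (tent K x₀ ε y) =
    min (ENNReal.ofReal ε) (⨅ σ : K, GraphDist.gdist y (σ • x₀)) :=
  ENNReal.ofReal_toReal ((min_le_left _ _).trans_lt ENNReal.ofReal_lt_top).ne

theorem tent_nonneg (y : X) : 0 ≤ tent K x₀ ε y := ENNReal.toReal_nonneg

theorem tent_le (hε : 0 ≤ ε) (y : X) : tent K x₀ ε y ≤ ε := by
  rw [← ENNReal.ofReal_le_ofReal_iff hε, ofReal_tent]
  exact min_le_left _ _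

theorem tent_smul (hK : IsIsometricAction K X) (σ : K) (y : X) :
    tent K x₀ ε (σ • y) = tent K x₀ ε y := by
  unfold tent
  congr 2
  refine (Equiv.mulLeft σ⁻¹).iInf_congr fun τ => ?_
  rw [gdist_smul_left hK, Equiv.coe_mulLeft, mul_smul]

/-- The truncated distance is 1-Lipschitz. -/
theorem tent_le_add (M : Model X) {p q : X} {d : ℝ} (hd : 0 ≤ d)
    (h : GraphDist.gdist p q ≤ ENNReal.ofReal d) : tent K x₀ ε p ≤ d + tent K x₀ ε q := by
  have h0 : 0 ≤ tent K x₀ ε q := tent_nonneg q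
  rw [← ENNReal.ofReal_le_ofReal_iff (by linarith), ENNReal.ofReal_add hd h0, ofReal_tent,
    ofReal_tent, min_def (ENNReal.ofReal ε) (⨅ σ : K, GraphDist.gdist q (σ • x₀))]
  split_ifs
  · exact (min_le_left _ _).trans le_add_self
  · refine (min_le_right _ _).trans ?_
    rw [ENNReal.add_iInf]
    exact le_iInf fun σ => (iInf_le _ σ).trans
      ((M.gdist_triangle _ q _).trans (add_le_add h le_rfl))

variable {e : M.E} {t : ℝ}

/-- Other points of the orbit are at distance at least `2 * ε` from the centre, so within radius `ε`
the centre is a nearest one. -/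
theorem tent_pr (hε : 2 * ε ≤ t) (hlen : ENNReal.ofReal (t + 2 * ε) ≤ M.len e)
    (horb : ∀ σ : K, σ • M.pr e t ≠ M.pr e t →
      ENNReal.ofReal (2 * ε) ≤ GraphDist.gdist (M.pr e t) (σ • M.pr e t))
    {u : ℝ} (hu : |u - t| < ε) : tent K (M.pr e t) ε (M.pr e u) = |u - t| := by
  have h0 := abs_nonneg (u - t)
  have hd : GraphDist.gdist (M.pr e t) (M.pr e u) = ENNReal.ofReal |u - t| :=
    gdist_pr_of_abs_lt hε hlen (by linarith)
  rw [← ENNReal.ofReal_eq_ofReal_iff (tent_nonneg _) h0, ofReal_tent]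
  refine le_antisymm ((min_le_right _ _).trans ((iInf_le _ 1).trans ?_))
    (le_min (ENNReal.ofReal_le_ofReal hu.le) (le_iInf fun σ => ?_))
  · rw [one_smul, M.gdist_comm, hd]
  · by_cases hσ : σ • M.pr e t = M.pr e t
    · rw [hσ, M.gdist_comm, hd]
    · have h1 := (horb σ hσ).trans (M.gdist_triangle _ (M.pr e u) _)
      rw [hd] at h1
      refine le_trans ?_ (tsub_le_iff_left.2 h1)
      rw [← ENNReal.ofReal_sub _ h0]
      exact ENNReal.ofReal_le_ofReal (by linarith)

theorem exists_of_tent_lt (hK : IsIsometricAction K X) (hε0 : 0 < ε) (hε : 2 * ε ≤ t)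
    (hlen : ENNReal.ofReal (t + 2 * ε) ≤ M.len e) {y : X}
    (hy : tent K (M.pr e t) ε y < ε) : ∃ (σ : K) (u : ℝ), |u - t| < ε ∧ y = σ • M.pr e u := by
  rw [← ENNReal.ofReal_lt_ofReal_iff hε0, ofReal_tent, min_lt_iff, or_iff_right (lt_irrefl _),
    iInf_lt_iff] at hy
  obtain ⟨σ, hσ⟩ := hy
  rw [M.gdist_comm, gdist_smul_left hK] at hσ
  obtain ⟨u, hu, heq, -⟩ := exists_of_gdist_lt_inner hσ (by linarith)
    ((ENNReal.ofReal_le_ofReal (by linarith)).trans hlen)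
  exact ⟨σ, u, hu, by rw [← heq, smul_inv_smul]⟩

theorem continuous_pr (M : Model X) (e : M.E) :
    ContinuousOn (M.pr e) {u | ENNReal.ofReal u ≤ M.len e} :=
  (M.param_continuousOn e).comp ENNReal.continuous_ofReal.continuousOn
    fun _ hu => ⟨zero_le, hu⟩

/-- The closed `ε`-arcs about the finitely many orbit points form a compact set, outside which the
tent is constant. Compactness is used in the topology of the graph, so points at infinity are
covered too. -/
theorem tent_eventually_eq [Finite K] (hK : IsIsometricAction K X) (hε0 : 0 < ε)
    (hε : 2 * ε ≤ t) (hlen : ENNReal.ofReal (t + 2 * ε) ≤ M.len e) {x : X}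
    (hx : ∀ (σ : K) (u : ℝ), |u - t| ≤ ε → x ≠ σ • M.pr e u) :
    ∀ᶠ y in 𝓝 x, tent K (M.pr e t) ε y = ε := by
  have := M.t2
  have hcl : IsClosed (⋃ σ : K, (fun u => σ • M.pr e u) '' Icc (t - ε) (t + ε)) := by
    refine isClosed_iUnion_of_finite fun σ => ?_
    refine (isCompact_Icc.image_of_continuousOn
      ((hK σ).1.comp_continuousOn ((M.continuous_pr e).mono fun u hu => ?_))).isClosed
    exact (ENNReal.ofReal_le_ofReal (by linarith [hu.2])).trans hlen
  have hx' : x ∉ ⋃ σ : K, (fun u => σ • M.pr e u) '' Icc (t - ε) (t + ε) := by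
    intro h
    obtain ⟨σ, u, hu, rfl⟩ := mem_iUnion.1 h
    exact hx σ u (abs_le.2 ⟨by linarith [hu.1], by linarith [hu.2]⟩) rfl
  filter_upwards [hcl.isOpen_compl.mem_nhds hx'] with y hy
  by_contra hne
  obtain ⟨σ, u, hu, rfl⟩ := exists_of_tent_lt hK hε0 hε hlen
    (lt_of_le_of_ne (tent_le hε0.le y) hne)
  obtain ⟨h1, h2⟩ := abs_lt.1 hu
  exact hy (mem_iUnion.2 ⟨σ, u, ⟨by linarith, by linarith⟩, rfl⟩)

theorem ne_smul_of_atInfinity (hK : IsIsometricAction K X) {x : X} (hx : M.AtInfinity x) {u : ℝ}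
    (hu : M.Inner e u) (σ : K) : x ≠ σ • M.pr e u := by
  rintro rfl
  exact hu.notMem (AtInfinity.of_smul hK hx).mem_V

/-- At finite parameters the Lipschitz bound suffices. It says nothing at a parameter `∞`, where
instead the tent is locally constant. -/
theorem continuous_tent [Finite K] (hK : IsIsometricAction K X) (hε0 : 0 < ε)
    (hε : 2 * ε ≤ t) (hlen : ENNReal.ofReal (t + 2 * ε) ≤ M.len e) :
    Continuous (tent K (M.pr e t) ε) := by
  refine M.continuous_of_continuousOn_edges fun e' s hs => ?_
  rcases eq_or_ne s ⊤ with rfl | hst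
  · have he' : M.len e' = ⊤ := top_le_iff.1 hs.2
    have hinf : M.AtInfinity (M.param e' ⊤) := ⟨e', he', rfl⟩
    have hev := tent_eventually_eq hK hε0 hε hlen (x := M.param e' ⊤) fun σ u hu =>
      ne_smul_of_atInfinity hK hinf (inner_of_abs_lt (δ := 2 * ε) hε hlen (by linarith)) σ
    have hev' := (M.param_continuousOn e' ⊤ hs).eventually hev
    refine (continuousWithinAt_const (b := ε)).congr_of_eventuallyEq hev' hev.self_of_nhds
  · have h0 : Tendsto (fun s' : ℝ≥0∞ => |s.toReal - s'.toReal|) (𝓝 s) (𝓝 0) := by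
      have := (ENNReal.continuousAt_toReal hst).tendsto
      have := (tendsto_const_nhds (x := s.toReal)).sub this
      simpa using this.abs
    rw [ContinuousWithinAt, tendsto_iff_dist_tendsto_zero]
    refine squeeze_zero' (Eventually.of_forall fun _ => dist_nonneg) ?_
      (h0.mono_left nhdsWithin_le_nhds)
    filter_upwards [self_mem_nhdsWithin,
      nhdsWithin_le_nhds ((isOpen_ne (x := (⊤ : ℝ≥0∞))).mem_nhds hst)] with s' hs' hs't
    have hd : GraphDist.gdist (M.param e' s) (M.param e' s') ≤
        ENNReal.ofReal |s.toReal - s'.toReal| := by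
      have := M.gdist_param_le e' hs.2 hs'.2
      rwa [← ENNReal.ofReal_toReal hst, ← ENNReal.ofReal_toReal hs't,
        ofReal_abs_sub ENNReal.toReal_nonneg ENNReal.toReal_nonneg,
        ENNReal.ofReal_toReal hst, ENNReal.ofReal_toReal hs't] at this
    have h1 := tent_le_add (K := K) (x₀ := M.pr e t) (ε := ε) M (abs_nonneg _) hd
    have h2 := tent_le_add (K := K) (x₀ := M.pr e t) (ε := ε) M (abs_nonneg _)
      (M.gdist_comm _ _ ▸ hd)
    rw [Real.dist_eq, abs_le]
    constructor <;> linarith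

end Tent

end Model

namespace Model

variable {X : Type*} [TopologicalSpace X] [GraphDist X] {M : Model X}
  {K : Type*} [Group K] [MulAction K X]

/-! ### Firing chips from an orbit -/

/-- Two parameters of agreement determine an affine function. Frequent agreement is what remains
after splitting a maximum along a ray into its two branches. -/
theorem affine_coeff_eq_of_frequently {a b : ℝ} {s s' : ℤ}
    (h : ∃ᶠ u : ℝ in atTop, a + s * u = b + s' * u) : a = b ∧ s = s' := by
  obtain ⟨u, hu⟩ := h.exists
  obtain ⟨v, hv, huv⟩ := (h.and_eventually (eventually_gt_atTop u)).exists
  have h1 : ((s : ℝ) - s') * (v - u) = 0 := by linear_combination hv - hu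
  have h2 : (s : ℝ) - s' = 0 := (mul_eq_zero.1 h1).resolve_right (sub_ne_zero.2 huv.ne')
  have h3 : s = s' := by exact_mod_cast sub_eq_zero.1 h2
  subst h3
  exact ⟨by linarith, rfl⟩

/-- Near a point at infinity, the slope of a rational function in any model is the negative of
its order. -/
theorem AffineWith.eventually_eq_atTop {M' : Model X} {f : X → EReal} {s : M'.E → ℤ}
    (hf : M'.AffineWith f s) {e : M.E} (he : M.len e = ⊤) :
    ∃ b : ℝ, ∀ᶠ u in atTop,
      f (M.pr e u) = ((b + (-M'.ord s (M.param e ⊤) : ℤ) * u : ℝ) : EReal) := by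
  obtain ⟨e', he', hp⟩ := AtInfinity.transfer (M₁ := M) M' ⟨e, he, rfl⟩
  obtain ⟨c, hc⟩ := exists_transition_top M M' he he' hp.symm
  obtain ⟨a, ha⟩ := hf.eq_pr e'
  refine ⟨a + s e' * c, ?_⟩
  filter_upwards [hc, eventually_ge_atTop (-c)] with u hu hu0
  rw [hu, ha _ (by linarith) (by rw [he']; exact le_top), ← hp, M'.ord_of_infinite s he', neg_neg]
  congr 1
  ring

/-- The function obtained from `h` by firing one chip in each direction from the points of the
orbit of `x₀`. -/
noncomputable def fire (K : Type*) [Group K] [MulAction K X] (h : X → EReal) (x₀ : X) (ε : ℝ)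
    (x : X) : EReal :=
  h x + ((-tent K x₀ ε x : ℝ) : EReal)

/-- A `K`-invariant function `h` that has a convex kink from slope `p` to slope `q` at the point
`M.pr e t`. The number `ε` is a radius within which nothing else happens. -/
structure HasKink (M : Model X) (K : Type*) [Group K] [MulAction K X] (h : X → EReal) (e : M.E)
    (t ε A : ℝ) (p q : ℤ) : Prop where
  pos : 0 < ε
  le : 2 * ε ≤ t
  le_len : ENNReal.ofReal (t + 2 * ε) ≤ M.len e
  orbit : ∀ σ : K, σ • M.pr e t ≠ M.pr e t →
    ENNReal.ofReal (2 * ε) ≤ GraphDist.gdist (M.pr e t) (σ • M.pr e t)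
  eq : ∀ u, |u - t| < 2 * ε →
    h (M.pr e u) = ((A + max (p * (u - t)) (q * (u - t)) : ℝ) : EReal)
  isPL : M.IsPL h
  inv : IsInvariantFun K h

variable {h : X → EReal} {e : M.E} {t ε A : ℝ} {p q : ℤ}

theorem HasKink.inner (hk : HasKink M K h e t ε A p q) {u : ℝ} (hu : |u - t| < 2 * ε) :
    M.Inner e u := inner_of_abs_lt hk.le hk.le_len hu

theorem fire_invariant (hK : IsIsometricAction K X) (hinv : IsInvariantFun K h) (x₀ : X) (ε : ℝ) :
    IsInvariantFun K (fire K h x₀ ε) := by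
  intro σ x
  rw [fire, fire, hinv, tent_smul hK]

theorem HasKink.fire_eq (hk : HasKink M K h e t ε A p q) {u : ℝ} (hu : |u - t| < ε) :
    fire K h (M.pr e t) ε (M.pr e u) =
      ((A + max (p * (u - t)) (q * (u - t)) - |u - t| : ℝ) : EReal) := by
  rw [fire, hk.eq u (by linarith [hk.pos]), tent_pr hk.le hk.le_len hk.orbit hu, ← EReal.coe_add]
  rfl

/-- Subtracting `|u - t|` raises the left slope by one and lowers the right slope by one; `p + 2 ≤
q` is exactly `p + 1 ≤ q - 1`, so the result is still a maximum. -/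
theorem HasKink.fire_eq_max (hk : HasKink M K h e t ε A p q) (hpq : p + 2 ≤ q) {u : ℝ}
    (hu : |u - t| < ε) : fire K h (M.pr e t) ε (M.pr e u) =
      ((A + max ((p + 1) * (u - t)) ((q - 1) * (u - t)) : ℝ) : EReal) := by
  rw [hk.fire_eq hu]
  have hpq' : (p : ℝ) + 2 ≤ q := by exact_mod_cast hpq
  congr 1
  rcases le_total 0 (u - t) with h0 | h0
  · rw [abs_of_nonneg h0, max_eq_right (by nlinarith), max_eq_right (by nlinarith)]; ring
  · rw [abs_of_nonpos h0, max_eq_left (by nlinarith), max_eq_left (by nlinarith)]; ring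

theorem HasKink.locAff_fire (hk : HasKink M K h e t ε A p q) (hpq : p + 2 ≤ q) {u : ℝ}
    (hu : |u - t| < ε) (hne : u ≠ t) : M.LocAff (fire K h (M.pr e t) ε) e u := by
  have hpq' : (p : ℝ) + 2 ≤ q := by exact_mod_cast hpq
  have hev : ∀ᶠ v in 𝓝 u, |v - t| < ε :=
    (isOpen_lt (f := fun v : ℝ => |v - t|) (g := fun _ => ε) (by fun_prop)
      (by fun_prop)).mem_nhds hu
  rcases hne.lt_or_gt with hlt | hgt
  · refine ⟨A - (p + 1) * t, p + 1, ?_⟩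
    filter_upwards [hev, eventually_lt_nhds hlt] with v hv hvt
    rw [hk.fire_eq_max hpq hv, max_eq_left (by nlinarith)]
    congr 1; push_cast; ring
  · refine ⟨A - (q - 1) * t, q - 1, ?_⟩
    filter_upwards [hev, eventually_gt_nhds hgt] with v hv hvt
    rw [hk.fire_eq_max hpq hv, max_eq_right (by nlinarith)]
    congr 1; push_cast; ring

theorem Inner.continuousAt_pr {M : Model X} {e : M.E} {t : ℝ} (ht : M.Inner e t) :
    ContinuousAt (M.pr e) t :=
  ((M.continuous_pr e).mono fun _ hu => hu.2.le).continuousAt ((M.isOpen_inner e).mem_nhds ht)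

/-- New break points occur only on the orbits of the centre and of the two ends `t - ε`, `t + ε` of
the arc. Inside the translated arcs invariance reduces to `locAff_fire`; outside them the tent is
constant. -/
theorem HasKink.isPL_fire [Finite K] (hk : HasKink M K h e t ε A p q)
    (hK : IsIsometricAction K X) (hpq : p + 2 ≤ q) : M.IsPL (fire K h (M.pr e t) ε) := by
  obtain ⟨hc, hfin, S, hS, hloc⟩ := hk.isPL
  have hinv := fire_invariant hK hk.inv (M.pr e t) ε
  refine ⟨continuous_add_coe hc (continuous_tent hK hk.pos hk.le hk.le_len).neg,
    fun x hx => hfin x ?_,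
    S ∪ ⋃ σ : K, (fun u => σ • M.pr e u) '' {t - ε, t, t + ε},
    hS.union (finite_iUnion fun σ => (toFinite _).image _), fun e' t' ht' hp => ?_⟩
  · change h x + _ = ⊤ ∨ h x + _ = ⊥ at hx
    generalize h x = y at hx ⊢
    induction y with
    | bot => exact .inr rfl
    | coe r =>
      rw [← EReal.coe_add] at hx
      exact (hx.elim (EReal.coe_ne_top _) (EReal.coe_ne_bot _)).elim
    | top => exact .inl rfl
  · rw [mem_union, not_or, mem_iUnion, not_exists] at hp
    by_cases hlt : tent K (M.pr e t) ε (M.pr e' t') < ε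
    · obtain ⟨σ, u, hu, heq⟩ := exists_of_tent_lt hK hk.pos hk.le hk.le_len hlt
      have hut : u ≠ t := by
        rintro rfl
        exact hp.2 σ ⟨u, by simp, heq.symm⟩
      exact (hk.locAff_fire hpq hu hut).of_smul hK hinv (hk.inner (by linarith [hk.pos])) ht' heq
    · have hev := tent_eventually_eq hK hk.pos hk.le hk.le_len (x := M.pr e' t') fun σ u hu heq => by
        rcases hu.lt_or_eq with h1 | h1
        · rw [heq, tent_smul hK, tent_pr hk.le hk.le_len hk.orbit h1] at hlt
          exact hlt h1
        · refine hp.2 σ ⟨u, ?_, heq.symm⟩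
          rcases abs_choice (u - t) with h2 | h2
          · right; right; rw [mem_singleton_iff]; linarith
          · left; linarith
      obtain ⟨a, s, ha⟩ := hloc e' t' ht' hp.1
      refine ⟨a - ε, s, ?_⟩
      filter_upwards [ha, ht'.continuousAt_pr.eventually hev] with v h1 h2
      rw [fire, h1, h2, ← EReal.coe_add]
      congr 1; ring

/-- The sum of the increments of `f` on a sphere. -/
noncomputable def sphereSum (f : X → EReal) (x : X) (r : ℝ) : ℝ :=
  ∑ᶠ y ∈ gsphere x r, ((f y).toReal - (f x).toReal)

theorem sphereSum_smul (hK : IsIsometricAction K X) {f : X → EReal} (hf : IsInvariantFun K f)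
    (σ : K) (x : X) (r : ℝ) : sphereSum f (σ • x) r = sphereSum f x r := by
  rw [sphereSum, gsphere_smul hK, finsum_mem_image ((MulAction.injective σ).injOn)]
  simp only [hf σ]
  rfl

/-- Along the arc the fired function is convex, being a maximum of two affine functions. -/
theorem HasKink.eventually_sphereSum_nonneg (hk : HasKink M K h e t ε A p q) (hpq : p + 2 ≤ q)
    {u : ℝ} (hu : |u - t| < ε) :
    ∀ᶠ r in 𝓝[>] (0 : ℝ), 0 ≤ sphereSum (fire K h (M.pr e t) ε) (M.pr e u) r := by
  have hpq' : (p : ℝ) + 2 ≤ q := by exact_mod_cast hpq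
  obtain ⟨h1, h2⟩ := abs_lt.1 hu
  have hpos : 0 < ε - |u - t| := by linarith
  have ha : ENNReal.ofReal (u + (ε - |u - t|)) ≤ M.len e :=
    (ENNReal.ofReal_le_ofReal (by linarith [le_abs_self (u - t)])).trans hk.le_len
  have hb : ε - |u - t| ≤ u := by linarith [neg_abs_le (u - t), hk.le]
  filter_upwards [Ioo_mem_nhdsGT hpos] with r hr
  have hr2 := hr.2
  have e1 : |u - r - t| < ε := by
    have := abs_sub_le (u - r) u t
    rw [sub_sub_cancel_left, abs_neg, abs_of_pos hr.1] at this
    linarith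
  have e2 : |u + r - t| < ε := by
    have := abs_sub_le (u + r) u t
    rw [add_sub_cancel_left, abs_of_pos hr.1] at this
    linarith
  rw [sphereSum, sphere_inner hb ha hr.1 hr.2, finsum_mem_pair (sphere_inner_ne hb ha hr.1 hr.2),
    hk.fire_eq_max hpq hu, hk.fire_eq_max hpq e1, hk.fire_eq_max hpq e2]
  simp only [EReal.toReal_coe]
  have a1 := le_max_left (((p : ℝ) + 1) * (u - r - t)) ((q - 1) * (u - r - t))
  have a2 := le_max_right (((p : ℝ) + 1) * (u - r - t)) ((q - 1) * (u - r - t))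
  have a3 := le_max_left (((p : ℝ) + 1) * (u + r - t)) ((q - 1) * (u + r - t))
  have a4 := le_max_right (((p : ℝ) + 1) * (u + r - t)) ((q - 1) * (u + r - t))
  rcases max_choice (((p : ℝ) + 1) * (u - t)) ((q - 1) * (u - t)) with hm | hm <;> rw [hm] <;>
    linarith

theorem not_atInfinity_of_mem_gsphere {x y : X} {r : ℝ} (hx : ¬ M.AtInfinity x)
    (hy : y ∈ gsphere x r) : ¬ M.AtInfinity y := by
  intro h
  have hy' : GraphDist.gdist x y = ENNReal.ofReal r := hy
  have hne : x ≠ y := by rintro rfl; exact hx h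
  rw [M.gdist_comm, h.gdist_eq_top hne] at hy'
  exact ENNReal.ofReal_ne_top hy'.symm

/-- If `h'` lies above `f`, up to a constant, with equality at the point `x`, then the order of
`h'` at `x` is at least that of `f`. -/
theorem ord_le_ord_of_le {M₁ M₂ : Model X} {f h' : X → EReal} {s₁ : M₁.E → ℤ} {s₂ : M₂.E → ℤ}
    (h₁ : M₁.AffineWith f s₁) (h₂ : M₂.AffineWith h' s₂) {x : X} (hx : ¬ M.AtInfinity x) {c : ℝ}
    (heq : h' x = f x + c) (hle : ∀ y, f y + c ≤ h' y) : M₁.ord s₁ x ≤ M₂.ord s₂ x := by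
  have e1 := h₁.eventually_sum_sphere (fun h => hx (h.transfer M))
  have e2 := h₂.eventually_sum_sphere (fun h => hx (h.transfer M))
  obtain ⟨r, ⟨⟨hfin, hr1⟩, -, hr2⟩, hr0⟩ := ((e1.and e2).and self_mem_nhdsWithin).exists
  have hsum : ∑ᶠ y ∈ gsphere x r, ((f y).toReal - (f x).toReal) ≤
      ∑ᶠ y ∈ gsphere x r, ((h' y).toReal - (h' x).toReal) := by
    rw [finsum_mem_eq_finite_toFinset_sum _ hfin, finsum_mem_eq_finite_toFinset_sum _ hfin]
    refine Finset.sum_le_sum fun y hy => ?_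
    have hy' := not_atInfinity_of_mem_gsphere hx (hfin.mem_toFinset.1 hy)
    obtain ⟨a, ha⟩ := (h₁.isPL M).exists_real hx
    obtain ⟨b, hb⟩ := (h₁.isPL M).exists_real hy'
    obtain ⟨d, hd⟩ := (h₂.isPL M).exists_real hy'
    have hle' := hle y
    rw [hb, hd, ← EReal.coe_add, EReal.coe_le_coe_iff] at hle'
    rw [heq, ha, hb, hd, ← EReal.coe_add]
    simp only [EReal.toReal_coe]
    linarith
  rw [hr1, hr2] at hsum
  exact_mod_cast le_of_mul_le_mul_left hsum hr0

/-- Effectivity is checked point by point. At infinity the tent is constant, so the new function has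
there the order of `f` or of `g`. Inside the arcs its order is nonnegative by convexity, and `D` is
effective. Elsewhere the tent takes its largest value `ε`, so the new function touches from above a
constant shift of `f` or of `g`, and its order is at least that of the touched function. -/
theorem exists_mem_RDInv_of_kink [Finite K] (hK : IsIsometricAction K X) {D : X →₀ ℤ}
    (hD : 0 ≤ D) {f g : X → EReal} {c : ℝ}
    (hf : ∃ E, IsDivOf f E ∧ 0 ≤ D + E) (hg : ∃ E, IsDivOf g E ∧ 0 ≤ D + E)
    (hk : HasKink M K (fun x => max (f x + c) (g x)) e t ε A p q) (hpq : p + 2 ≤ q) :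
    fire K (fun x => max (f x + c) (g x)) (M.pr e t) ε ∈ RDInv K D := by
  classical
  obtain ⟨E₁, ⟨M₁, s₁, h₁, hE₁⟩, hDE₁⟩ := hf
  obtain ⟨E₂, ⟨M₂, s₂, h₂, hE₂⟩, hDE₂⟩ := hg
  have hPL := hk.isPL_fire hK hpq
  have hinv := fire_invariant hK hk.inv (M.pr e t) ε
  obtain ⟨M₃, s₃, h₃⟩ := hPL.exists_affineWith'
  refine ⟨.inr ⟨Finsupp.onFinset M₃.V (M₃.ord s₃) fun x hx => ?_, ⟨M₃, s₃, h₃, fun x => rfl⟩, ?_⟩,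
    hinv⟩
  · by_contra hxV
    exact hx (M₃.ord_eq_zero_of_notMem s₃ hxV)
  intro x
  have hD₁ : 0 ≤ D x + M₁.ord s₁ x := by
    have := hDE₁ x; rw [Finsupp.add_apply, hE₁] at this; exact this
  have hD₂ : 0 ≤ D x + M₂.ord s₂ x := by
    have := hDE₂ x; rw [Finsupp.add_apply, hE₂] at this; exact this
  change 0 ≤ D x + M₃.ord s₃ x
  by_cases hx : M.AtInfinity x
  · obtain ⟨e', he', rfl⟩ := id hx
    obtain ⟨b₁, k₁⟩ := h₁.eventually_eq_atTop he'
    obtain ⟨b₂, k₂⟩ := h₂.eventually_eq_atTop he'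
    obtain ⟨b₃, k₃⟩ := h₃.eventually_eq_atTop he'
    have hev := tent_eventually_eq hK hk.pos hk.le hk.le_len fun σ u hu =>
      ne_smul_of_atInfinity hK hx (hk.inner (by linarith [hk.pos])) σ
    have hev' := (M.tendsto_pr_top he').eventually hev
    -- Which branch attains the maximum may depend on `u`, but at least one of them does so for
    -- arbitrarily large `u`.
    have hor : (∃ᶠ u : ℝ in atTop, b₃ + ((-M₃.ord s₃ (M.param e' ⊤) : ℤ) : ℝ) * u =
          (b₁ + c - ε) + ((-M₁.ord s₁ (M.param e' ⊤) : ℤ) : ℝ) * u) ∨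
        (∃ᶠ u : ℝ in atTop, b₃ + ((-M₃.ord s₃ (M.param e' ⊤) : ℤ) : ℝ) * u =
          (b₂ - ε) + ((-M₂.ord s₂ (M.param e' ⊤) : ℤ) : ℝ) * u) := by
      rw [← frequently_or_distrib]
      refine Eventually.frequently ?_
      filter_upwards [k₁, k₂, k₃, hev'] with u w₁ w₂ w₃ w₄
      rw [fire, w₁, w₂, w₄, ← EReal.coe_add, ← EReal.coe_strictMono.monotone.map_max, ← EReal.coe_add,
        EReal.coe_eq_coe_iff] at w₃
      rcases max_choice (b₁ + ((-M₁.ord s₁ (M.param e' ⊤) : ℤ) : ℝ) * u + c)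
        (b₂ + ((-M₂.ord s₂ (M.param e' ⊤) : ℤ) : ℝ) * u) with hm | hm
      · left; rw [hm] at w₃; linarith
      · right; rw [hm] at w₃; linarith
    rcases hor with hor | hor
    · have := (affine_coeff_eq_of_frequently hor).2; omega
    · have := (affine_coeff_eq_of_frequently hor).2; omega
  · by_cases hlt : tent K (M.pr e t) ε x < ε
    · obtain ⟨σ, u, hu, rfl⟩ := exists_of_tent_lt hK hk.pos hk.le hk.le_len hlt
      have e1 := hk.eventually_sphereSum_nonneg hpq hu
      have e2 := h₃.eventually_sum_sphere (fun h => hx (h.transfer M))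
      obtain ⟨r, ⟨hr1, -, hr2⟩, hr0⟩ := ((e1.and e2).and self_mem_nhdsWithin).exists
      change sphereSum _ _ _ = _ at hr2
      rw [← sphereSum_smul hK hinv σ, hr2] at hr1
      have h4 : (0 : ℝ) ≤ M₃.ord s₃ (σ • M.pr e u) := nonneg_of_mul_nonneg_right hr1 hr0
      have h5 : 0 ≤ M₃.ord s₃ (σ • M.pr e u) := by exact_mod_cast h4
      have h6 : 0 ≤ D (σ • M.pr e u) := hD _
      omega
    · have hxε : tent K (M.pr e t) ε x = ε := le_antisymm (tent_le hk.pos.le x) (not_lt.1 hlt)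
      have hle : ∀ y, max (f y + c) (g y) + ((-ε : ℝ) : EReal) ≤
          fire K (fun x => max (f x + c) (g x)) (M.pr e t) ε y := fun y =>
        add_le_add le_rfl (EReal.coe_le_coe_iff.2 (neg_le_neg (tent_le hk.pos.le y)))
      have heq : fire K (fun x => max (f x + c) (g x)) (M.pr e t) ε x =
          max (f x + c) (g x) + ((-ε : ℝ) : EReal) := by rw [fire, hxε]
      rcases max_choice (f x + c) (g x) with hm | hm
      · have := ord_le_ord_of_le (c := c - ε) h₁ h₃ hx
          (by rw [heq, hm, add_assoc, ← EReal.coe_add]; rfl) fun y => by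
            refine le_trans ?_ (hle y)
            rw [sub_eq_add_neg, EReal.coe_add, ← add_assoc]
            exact add_le_add (le_max_left _ _) le_rfl
        omega
      · have := ord_le_ord_of_le (c := -ε) h₂ h₃ hx (by rw [heq, hm]) fun y =>
          (add_le_add (le_max_right _ _) le_rfl).trans (hle y)
        omega

end Model

namespace Model

/-! ### Slopes of a generating set -/

section Slopes

variable {X : Type*} [TopologicalSpace X] [GraphDist X] {M : Model X}
  {K : Type*} [Group K] [MulAction K X]

theorem eventually_le_gdist (M : Model X) {e : M.E} {t : ℝ} (ht : M.Inner e t) {y : X}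
    (hy : y ≠ M.pr e t) :
    ∀ᶠ ε in 𝓝[>] (0 : ℝ), ENNReal.ofReal (2 * ε) ≤ GraphDist.gdist (M.pr e t) y := by
  obtain ⟨δ, hδ, h1, h2⟩ := ht.exists_radius
  have hpos : GraphDist.gdist (M.pr e t) y ≠ 0 := by
    intro h0
    obtain ⟨s, -, rfl, hd⟩ := exists_of_gdist_lt_inner
      (by rw [h0]; exact ENNReal.ofReal_pos.2 hδ) h1 h2
    rw [h0, eq_comm, ENNReal.ofReal_eq_zero] at hd
    have : s - t = 0 := abs_eq_zero.1 (le_antisymm hd (abs_nonneg _))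
    exact hy (by rw [sub_eq_zero.1 this])
  have hlim : Tendsto (fun ε : ℝ => ENNReal.ofReal (2 * ε)) (𝓝 0) (𝓝 0) := by
    have : Continuous fun ε : ℝ => ENNReal.ofReal (2 * ε) :=
      ENNReal.continuous_ofReal.comp (by fun_prop)
    simpa using this.tendsto 0
  filter_upwards [nhdsWithin_le_nhds (hlim.eventually_lt_const (pos_iff_ne_zero.2 hpos))] with ε hε
  exact hε.le

theorem Inner.eventually_radius {e : M.E} {t : ℝ} (ht : M.Inner e t) :
    ∀ᶠ ε in 𝓝[>] (0 : ℝ), 2 * ε ≤ t ∧ ENNReal.ofReal (t + 2 * ε) ≤ M.len e := by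
  obtain ⟨δ, hδ, h1, h2⟩ := ht.exists_radius
  filter_upwards [Ioo_mem_nhdsGT (half_pos hδ)] with ε hε
  have := hε.2
  exact ⟨by linarith, (ENNReal.ofReal_le_ofReal (by linarith)).trans h2⟩

theorem eventually_forall_abs_lt {P : ℝ → Prop} {t : ℝ} (h : ∀ᶠ u in 𝓝 t, P u) :
    ∀ᶠ ε in 𝓝[>] (0 : ℝ), ∀ u, |u - t| < 2 * ε → P u := by
  obtain ⟨δ, hδ, h⟩ := Metric.eventually_nhds_iff.1 h
  filter_upwards [Ioo_mem_nhdsGT (half_pos hδ)] with ε hε u hu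
  have := hε.2
  exact h (by rw [Real.dist_eq]; linarith)

theorem exists_isDivOf_of_mem_RDInv {D : X →₀ ℤ} {f : X → EReal} (hf : f ∈ RDInv K D)
    (hne : ∃ x, f x ≠ ⊥) : ∃ E, IsDivOf f E ∧ 0 ≤ D + E := by
  rcases hf.1 with h | h
  · obtain ⟨x, hx⟩ := hne
    exact absurd (h x) hx
  · exact h

theorem isPL_of_isDivOf (M : Model X) {f : X → EReal} {E : X →₀ ℤ} (h : IsDivOf f E) :
    M.IsPL f := by
  obtain ⟨M', s, h, -⟩ := h
  exact h.isPL M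

/-- The slopes of a generating set of `R(D)^K` at a generic point leave no gaps. -/
theorem exists_slope_eq_add_one [Finite K] (hK : IsIsometricAction K X) {D : X →₀ ℤ}
    (hD : 0 ≤ D) {m : ℕ} {F : Fin m → X → EReal} (hF : Generates K F D)
    (hF' : ∀ i, ∃ x, F i x ≠ ⊥) {e : M.E} {t : ℝ} (ht : M.Inner e t) {α : Fin m → ℝ}
    {s : Fin m → ℤ}
    (hα : ∀ l, ∀ᶠ u in 𝓝 t, F l (M.pr e u) = ((α l + s l * u : ℝ) : EReal)) {i j : Fin m}
    (hij : s i + 2 ≤ s j) : ∃ l, s l = s i + 1 := by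
  have hdiv := fun l => exists_isDivOf_of_mem_RDInv (hF.1 l) (hF' l)
  have hPL : ∀ l, M.IsPL (F l) := fun l => by
    obtain ⟨E, hE, -⟩ := hdiv l; exact M.isPL_of_isDivOf hE
  have horb : ∀ᶠ ε in 𝓝[>] (0 : ℝ), ∀ σ : K, σ • M.pr e t ≠ M.pr e t →
      ENNReal.ofReal (2 * ε) ≤ GraphDist.gdist (M.pr e t) (σ • M.pr e t) := by
    refine eventually_all.2 fun σ => ?_
    by_cases h : σ • M.pr e t = M.pr e t
    · exact Eventually.of_forall fun ε hne => absurd h hne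
    · exact (M.eventually_le_gdist ht h).mono fun ε hε _ => hε
  obtain ⟨ε, ⟨⟨⟨hle, hlen⟩, horb⟩, hα⟩, hε⟩ := (((ht.eventually_radius.and horb).and
    (eventually_forall_abs_lt (eventually_all.2 hα))).and self_mem_nhdsWithin).exists
  have hε : 0 < ε := hε
  -- The constant is the difference of the two values at `t`, so that the graphs cross exactly
  -- there.
  have hk : HasKink M K (fun x => max (F i x + ((α j + s j * t - α i - s i * t : ℝ) : EReal))
      (F j x)) e t ε (α j + s j * t) (s i) (s j) :=
    { pos := hε
      le := hle
      le_len := hlen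
      orbit := horb
      eq := fun u hu => by
        simp only [hα u hu]
        rw [← EReal.coe_add, ← EReal.coe_strictMono.monotone.map_max, ← max_add_add_left]
        congr 2 <;> ring
      isPL := ((hPL i).add_const _).max (hPL j)
      inv := fun σ x => by simp only [(hF.1 _).2 σ x] }
  obtain ⟨a, ha, hsup⟩ := hF.2 _ (exists_mem_RDInv_of_kink hK hD (hdiv i) (hdiv j) hk hij)
  have hij' : (s i : ℝ) + 2 ≤ s j := by exact_mod_cast hij
  have hval : ∀ u, u < t → |u - t| < ε → ((α j + s j * t + (s i + 1) * (u - t) : ℝ) : EReal) =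
      Finset.univ.sup fun l => a l + F l (M.pr e u) := fun u hut hu => by
    rw [← hsup, hk.fire_eq_max hij hu, max_eq_left (by nlinarith)]
  have habs : ∀ δ, 0 < δ → δ < ε → |t - δ - t| < ε := fun δ h0 hδ => by
    rwa [sub_sub_cancel_left, abs_neg, abs_of_pos h0]
  -- Choose `l` attaining the supremum at `t - ε / 2`, on the left of the kink, where the fired
  -- function has slope `s i + 1`.
  have h0 := hval (t - ε / 2) (by linarith) (habs _ (by linarith) (by linarith))
  obtain ⟨l, -, hl⟩ := Finset.exists_mem_eq_sup Finset.univ ⟨i, Finset.mem_univ i⟩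
    fun l => a l + F l (M.pr e (t - ε / 2))
  rw [hl, hα _ ((habs _ (by linarith) (by linarith)).trans (by linarith))] at h0
  have hbot : a l ≠ ⊥ := by
    intro h
    rw [h, EReal.bot_add] at h0
    exact EReal.coe_ne_bot _ h0
  obtain ⟨b, hb⟩ : ∃ b : ℝ, a l = b := ⟨_, (EReal.coe_toReal (ha l) hbot).symm⟩
  rw [hb, ← EReal.coe_add, EReal.coe_eq_coe_iff] at h0
  have hle' : ∀ δ, 0 < δ → δ < ε → b + (α l + s l * (t - δ)) ≤
      α j + s j * t + (s i + 1) * (t - δ - t) := fun δ hδ0 hδ => by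
    have h1 := hval (t - δ) (by linarith) (habs δ hδ0 hδ)
    have h2 := Finset.le_sup (f := fun l => a l + F l (M.pr e (t - δ))) (Finset.mem_univ l)
    rw [← h1, hα _ ((habs δ hδ0 hδ).trans (by linarith)), hb, ← EReal.coe_add,
      EReal.coe_le_coe_iff] at h2
    exact h2
  -- The term of index `l` lies below the fired function on both sides of the point where they
  -- agree. Both are affine there, so their slopes coincide.
  have h3 := hle' (ε / 4) (by linarith) (by linarith)
  have h4 := hle' (3 * ε / 4) (by linarith) (by linarith)
  refine ⟨l, ?_⟩
  have h5 : ((s l : ℝ) - (s i + 1)) * ε = 0 := by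
    apply le_antisymm <;> linarith
  have h6 := (mul_eq_zero.1 h5).resolve_right hε.ne'
  have h7 : (s l : ℝ) = ((s i + 1 : ℤ) : ℝ) := by push_cast; linarith
  exact_mod_cast h7

/-- Unless all slopes agree, two of them are consecutive, and the gcd divides their difference 1. -/
theorem gcd_slopes_eq_one [Finite K] (hK : IsIsometricAction K X) {D : X →₀ ℤ}
    (hD : 0 ≤ D) {n : ℕ} {F : Fin (n + 1) → X → EReal} (hF : Generates K F D)
    (hF' : ∀ i, ∃ x, F i x ≠ ⊥) {e : M.E} {t : ℝ} (ht : M.Inner e t) {α : Fin (n + 1) → ℝ}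
    {s : Fin (n + 1) → ℤ}
    (hα : ∀ l, ∀ᶠ u in 𝓝 t, F l (M.pr e u) = ((α l + s l * u : ℝ) : EReal))
    (hne : ∃ i j, s i ≠ s j) : Finset.univ.gcd (fun l => s l - s 0) = 1 := by
  obtain ⟨i, j, hij⟩ : ∃ i j, s i < s j := by
    obtain ⟨i, j, h⟩ := hne
    rcases h.lt_or_gt with h | h
    · exact ⟨i, j, h⟩
    · exact ⟨j, i, h⟩
  obtain ⟨l, hl⟩ : ∃ l, s l = s i + 1 := by
    rcases (Int.add_one_le_of_lt hij).eq_or_lt with h | h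
    · exact ⟨j, h.symm⟩
    · exact exists_slope_eq_add_one hK hD hF hF' ht hα (i := i) (j := j) (by omega)
  have hdvd : ∀ k, Finset.univ.gcd (fun l => s l - s 0) ∣ s k - s 0 := fun k =>
    Finset.gcd_dvd (Finset.mem_univ k)
  have h1 : Finset.univ.gcd (fun l => s l - s 0) ∣ 1 := by
    have := dvd_sub (hdvd l) (hdvd i)
    rwa [hl, show s i + 1 - s 0 - (s i - s 0) = 1 by ring] at this
  rw [← Finset.normalize_gcd]
  exact normalize_eq_one.2 (isUnit_of_dvd_one h1)

end Slopes

theorem ratMap_eq_ofReal {X : Type*} [TopologicalSpace X] {n : ℕ} {F : Fin (n + 1) → X → EReal}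
    {x : X} {v : Fin (n + 1) → ℝ} (h : ∀ i, F i x = v i) : ratMap F x = TP.ofReal v := by
  have hfun : (fun i => F i x) = fun i => (v i : EReal) := funext h
  have hc : IsHomCoord fun i => F i x :=
    ⟨fun i => by simp only [h]; exact EReal.coe_ne_top _,
      0, by simp only [h]; exact EReal.coe_ne_bot _⟩
  rw [ratMap, dif_pos hc, TP.ofReal]
  congr 1

/-! ### Dilations -/

section Dilation

variable {X Y : Type*} [TopologicalSpace X] [GraphDist X] [TopologicalSpace Y] [GraphDist Y]
  {M : Model X} {N : Model Y} {φ : X → Y}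

/-- Puts both orientations into the single form `c + σ * (k * u)` with `σ = ±1`, in real
coordinates. -/
theorem exists_of_dilatesOnto {k : ℕ} (hk : 0 < k) {e : M.E} {e' : N.E} {flip : Bool}
    (h : DilatesOnto M N φ k e e' flip) :
    ∃ (c : ℝ) (σ : ℤ), |(σ : ℝ)| = 1 ∧ ∀ u, M.Inner e u →
      N.Inner e' (c + σ * (k * u)) ∧ φ (M.pr e u) = N.pr e' (c + σ * (k * u)) := by
  obtain ⟨hlen, h1, h2⟩ := h
  have hk0 : (k : ℝ≥0∞) ≠ 0 := by exact_mod_cast hk.ne'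
  have hkt : (k : ℝ≥0∞) ≠ ⊤ := ENNReal.natCast_ne_top k
  have hkR : (0 : ℝ) < k := by exact_mod_cast hk
  have hmul : ∀ u : ℝ, ENNReal.ofReal (k * u) = k * ENNReal.ofReal u := fun u => by
    rw [ENNReal.ofReal_mul hkR.le, ENNReal.ofReal_natCast]
  have hlt : ∀ u, M.Inner e u → ENNReal.ofReal (k * u) < N.len e' := fun u hu => by
    rw [hmul, hlen]
    exact (ENNReal.mul_lt_mul_iff_right hk0 hkt).2 hu.2
  cases flip
  · refine ⟨0, 1, by simp, fun u hu => ?_⟩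
    simp only [Int.cast_one, one_mul, zero_add]
    refine ⟨⟨mul_pos hkR hu.1, hlt u hu⟩, ?_⟩
    rw [pr, pr, hmul]
    exact h1 rfl _ hu.2.le
  · obtain ⟨ht, h2⟩ := h2 rfl
    have hLt : N.len e' ≠ ⊤ := by rw [hlen]; exact ENNReal.mul_ne_top hkt ht
    refine ⟨(N.len e').toReal, -1, by simp, fun u hu => ?_⟩
    have hlt' := hlt u hu
    have hpos : 0 < k * u := mul_pos hkR hu.1
    rw [ENNReal.ofReal_lt_iff_lt_toReal hpos.le hLt] at hlt'
    have heq : (N.len e').toReal + ((-1 : ℤ) : ℝ) * (k * u) = (N.len e').toReal - k * u := by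
      push_cast; ring
    rw [heq]
    refine ⟨⟨by linarith, ?_⟩, ?_⟩
    · rw [ENNReal.ofReal_lt_iff_lt_toReal (by linarith) hLt]; linarith
    · rw [pr, pr, ENNReal.ofReal_sub _ hpos.le, ENNReal.ofReal_toReal hLt, hmul]
      exact h2 _ hu.2.le

theorem _root_.TropicalGraph.IsMorphism.exists_dilation {deg : M.E → ℕ}
    (h : IsMorphism M N φ deg) (hdeg : ∀ e, 0 < deg e) (e : M.E) :
    ∃ e' flip, DilatesOnto M N φ (deg e) e e' flip := by
  rcases h.dilation e with h | h
  · exact absurd h.1 (hdeg e).ne'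
  · exact h.2

theorem _root_.TropicalGraph.IsMorphism.map_atInfinity {deg : M.E → ℕ}
    (h : IsMorphism M N φ deg) (hdeg : ∀ e, 0 < deg e) {x : X} (hx : M.AtInfinity x) :
    N.AtInfinity (φ x) := by
  obtain ⟨e, he, rfl⟩ := hx
  obtain ⟨e', flip, hlen, h1, h2⟩ := h.exists_dilation hdeg e
  have hmul : (deg e : ℝ≥0∞) * ⊤ = ⊤ := ENNReal.mul_top (by exact_mod_cast (hdeg e).ne')
  rw [he, hmul] at hlen
  cases flip
  · exact ⟨e', hlen, by rw [h1 rfl ⊤ (by rw [he]), hmul]⟩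
  · exact absurd he (h2 rfl).1

/-- A finite dilation factor cannot send a finite parameter to `∞`, and a reversed edge is finite by
definition. -/
theorem _root_.TropicalGraph.IsMorphism.atInfinity_of_map {deg : M.E → ℕ}
    (h : IsMorphism M N φ deg) (hdeg : ∀ e, 0 < deg e) (hsurj : Function.Surjective φ) {x : X}
    (hx : N.AtInfinity (φ x)) : M.AtInfinity x := by
  have := hx.nontrivial
  have := hsurj.nontrivial
  obtain ⟨e, s, hs, rfl⟩ := M.exists_edge x
  obtain ⟨e', he', hp⟩ := hx
  obtain ⟨e'', flip, hlen, h1, h2⟩ := h.exists_dilation hdeg e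
  have hkt : (deg e : ℝ≥0∞) ≠ ⊤ := ENNReal.natCast_ne_top _
  cases flip
  · rw [h1 rfl s hs.2] at hp
    obtain ⟨-, ht⟩ := N.eq_top_of_param_eq he' (hlen ▸ mul_le_mul_right hs.2 _) hp.symm
    have hst : s = ⊤ := by
      by_contra hne
      exact ENNReal.mul_ne_top hkt hne ht
    exact ⟨e, top_le_iff.1 (hst ▸ hs.2), by rw [hst]⟩
  · obtain ⟨ht, h2⟩ := h2 rfl
    rw [h2 s hs.2] at hp
    obtain ⟨rfl, -⟩ := N.eq_top_of_param_eq he' tsub_le_self hp.symm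
    rw [he'] at hlen
    exact absurd hlen.symm (ENNReal.mul_ne_top hkt ht)

end Dilation

/-! ### The dilation factors of the rational map -/

/-- Finitely many functions have finitely many exceptional points, whereas the interior of an edge
is infinite. -/
theorem exists_generic {X : Type*} [TopologicalSpace X] [GraphDist X] (M : Model X) {ι : Type*}
    [Finite ι] {F : ι → X → EReal} (hF : ∀ i, M.IsPL (F i)) (e : M.E) :
    ∃ t, M.Inner e t ∧ ∀ i, M.LocAff (F i) e t := by
  choose hc hfin S hS hloc using hF
  have hfinite : (⋃ i, S i).Finite := finite_iUnion hS
  have hinj : InjOn (M.pr e) {t | M.Inner e t} := fun u hu v hv huv => (Inner.inj hv hu huv).2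
  obtain ⟨r₀, hr₀⟩ := exists_between (M.len_pos e)
  have hinf : {t | M.Inner e t}.Infinite :=
    infinite_of_mem_nhds _ ((M.isOpen_inner e).mem_nhds (Inner.of_mem_Ioo hr₀).1)
  have hfin' : ({t | M.Inner e t} ∩ M.pr e ⁻¹' (⋃ i, S i)).Finite := by
    refine Set.Finite.of_finite_image (hfinite.subset ?_) (hinj.mono inter_subset_left)
    rintro _ ⟨u, hu, rfl⟩
    exact hu.2
  obtain ⟨t, ht, hn⟩ := (hinf.sdiff hfin').nonempty
  exact ⟨t, ht, fun i => hloc i e t ht fun h => hn ⟨ht, mem_iUnion.2 ⟨i, h⟩⟩⟩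

/-- Near a generic point the image of an arc is a lattice segment of the same length as the arc,
because the gcd of the slope differences is 1. The dilation makes the distance of its ends `k` times
that length, and a distance cannot exceed the length of a path, so `k ≤ 1`. -/
theorem deg_eq_one {X : Type*} [TopologicalSpace X] [GraphDist X]
    {K : Type*} [Group K] [Finite K] [MulAction K X] (hK : IsIsometricAction K X) {D : X →₀ ℤ}
    (hD : 0 ≤ D) {n : ℕ} {F : Fin (n + 1) → X → EReal} (hF : Generates K F D)
    (hF' : ∀ i, ∃ x, F i x ≠ ⊥) {M : Model X} {N : Model (range (ratMap F))} {k : ℕ}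
    (hk : 0 < k) {e : M.E} {e' : N.E} {flip : Bool}
    (h : DilatesOnto M N (rangeFactorization (ratMap F)) k e e' flip) : k = 1 := by
  have hPL : ∀ l, M.IsPL (F l) := fun l => by
    obtain ⟨E, hE, -⟩ := exists_isDivOf_of_mem_RDInv (hF.1 l) (hF' l)
    exact M.isPL_of_isDivOf hE
  obtain ⟨c, σ, hσ, hφ⟩ := exists_of_dilatesOnto hk h
  obtain ⟨t, ht, hloc⟩ := M.exists_generic hPL e
  choose α s hα using hloc
  have hkR : (0 : ℝ) < k := by exact_mod_cast hk
  have hσ0 : (σ : ℝ) ≠ 0 := fun h => by rw [h, abs_zero] at hσ; exact zero_ne_one hσ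
  have hN := (hφ t ht).1.eventually_gdist
  have hcont : Tendsto (fun u : ℝ => c + σ * (k * u)) (𝓝 t) (𝓝 (c + σ * (k * t))) :=
    (by fun_prop : Continuous fun u : ℝ => c + σ * (k * u)).tendsto t
  obtain ⟨δ, hδ, hball⟩ := Metric.eventually_nhds_iff.1
    ((eventually_all.2 hα).and (ht.eventually.and (hcont.eventually hN)))
  have hδ' : ∀ v ∈ Icc t (t + δ / 2), dist v t < δ := fun v hv => by
    rw [Real.dist_eq, abs_lt]; constructor <;> linarith [hv.1, hv.2]
  have hrat : ∀ v ∈ Icc t (t + δ / 2),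
      ratMap F (M.pr e v) = TP.ofReal fun l => α l + s l * v := fun v hv =>
    ratMap_eq_ofReal (hball (hδ' v hv)).1
  set t' := t + δ / 2 with ht'
  have htmem : t ∈ Icc t t' := ⟨le_rfl, by linarith⟩
  have htmem' : t' ∈ Icc t t' := ⟨by linarith, le_rfl⟩
  obtain ⟨-, hin', hg⟩ := hball (hδ' t' htmem')
  -- Equal slopes would make the map constant on the arc, whereas a dilation with positive factor is
  -- injective there.
  have hne : ∃ i j, s i ≠ s j := by
    by_contra! hall
    have heq : ratMap F (M.pr e t) = ratMap F (M.pr e t') := by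
      rw [hrat t htmem, hrat t' htmem']
      refine Quotient.sound ⟨s 0 * (t - t'), fun i => ?_⟩
      change ((α i + s i * t : ℝ) : EReal) = _ + ((α i + s i * t' : ℝ) : EReal)
      rw [← EReal.coe_add, hall i 0]
      congr 1; ring
    have heq' : rangeFactorization (ratMap F) (M.pr e t) =
        rangeFactorization (ratMap F) (M.pr e t') := Subtype.ext heq
    rw [(hφ t ht).2, (hφ t' hin').2] at heq'
    have h1 := ((hφ t' hin').1.inj (hφ t ht).1 heq').2
    have h2 := mul_left_cancel₀ hkR.ne' (mul_left_cancel₀ hσ0 (add_left_cancel h1))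
    linarith
  have hgcd := gcd_slopes_eq_one hK hD hF hF' ht hα hne
  have hseg : LatticeSegment (range (ratMap F)) (rangeFactorization (ratMap F) (M.pr e t)).1
      (rangeFactorization (ratMap F) (M.pr e t')).1 (ENNReal.ofReal (t' - t)) := by
    refine ⟨fun l => α l + s l * t, s, t' - t, by linarith, hgcd, hrat t htmem, ?_, ?_, rfl⟩
    · refine (hrat t' htmem').trans ?_
      congr 1; funext l; ring
    · intro v hv
      refine ⟨M.pr e (t + v), ?_⟩
      rw [hrat (t + v) ⟨by linarith [hv.1], by linarith [hv.2]⟩]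
      congr 1; funext l; ring
  have hle : GraphDist.gdist (rangeFactorization (ratMap F) (M.pr e t))
      (rangeFactorization (ratMap F) (M.pr e t')) ≤ ENNReal.ofReal (t' - t) :=
    chainDist_le (.single hseg)
  rw [(hφ t ht).2, (hφ t' hin').2, hg, ENNReal.ofReal_le_ofReal_iff (by linarith),
    add_sub_add_left_eq_sub, ← mul_sub, ← mul_sub, abs_mul, hσ, one_mul, abs_mul,
    abs_of_pos hkR, abs_of_pos (by linarith : 0 < t' - t)] at hle
  have hk1 : (k : ℝ) ≤ 1 := le_of_mul_le_mul_right (by linarith) (by linarith : 0 < t' - t)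
  have : k ≤ 1 := by exact_mod_cast hk1
  omega

/-! ### Pulling back rational functions -/

section Pullback

variable {X Y : Type*} [TopologicalSpace X] [GraphDist X] [TopologicalSpace Y] [GraphDist Y]
  {M : Model X} {N : Model Y} {φ : X → Y} {deg : M.E → ℕ}

/-- The unit factor is essential for descent: a factor `k` would divide slopes by `k` and could
destroy integrality. Here slopes change only by the sign `σ`. -/
theorem _root_.TropicalGraph.IsMorphism.locAff_comp_iff (h : IsMorphism M N φ deg)
    (hdeg : ∀ e, deg e = 1) {g : Y → EReal} {e : M.E} {t : ℝ} (ht : M.Inner e t)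
    {e' : N.E} {t' : ℝ} (ht' : N.Inner e' t') (heq : φ (M.pr e t) = N.pr e' t') :
    M.LocAff (g ∘ φ) e t ↔ N.LocAff g e' t' := by
  obtain ⟨e'', flip, hd⟩ := h.exists_dilation (fun e => by rw [hdeg]; exact one_pos) e
  rw [hdeg] at hd
  obtain ⟨c, σ, hσ, hφ⟩ := exists_of_dilatesOnto one_pos hd
  simp only [Nat.cast_one, one_mul] at hφ
  have hσ2 : (σ : ℝ) * σ = 1 := by rw [← abs_mul_abs_self, hσ, one_mul]
  obtain ⟨h1, h2⟩ := hφ t ht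
  obtain ⟨rfl, rfl⟩ := ht'.inj h1 (h2.symm.trans heq)
  constructor
  · rintro ⟨a, s, hs⟩
    refine ⟨a - s * σ * c, s * σ, ?_⟩
    have hlim : Tendsto (fun v : ℝ => σ * (v - c)) (𝓝 (c + σ * t)) (𝓝 t) := by
      have := (by fun_prop : Continuous fun v : ℝ => σ * (v - c)).tendsto (c + σ * t)
      rwa [add_sub_cancel_left, ← mul_assoc, hσ2, one_mul] at this
    filter_upwards [hlim.eventually hs, hlim.eventually ht.eventually] with v hv hin
    have h3 := (hφ _ hin).2
    rw [← mul_assoc, hσ2, one_mul, add_sub_cancel] at h3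
    rw [← h3]
    refine Eq.trans hv ?_
    congr 1; push_cast; ring
  · rintro ⟨a, s, hs⟩
    refine ⟨a + s * c, s * σ, ?_⟩
    have hlim : Tendsto (fun u : ℝ => c + σ * u) (𝓝 t) (𝓝 (c + σ * t)) :=
      (by fun_prop : Continuous fun u : ℝ => c + σ * u).tendsto t
    filter_upwards [hlim.eventually hs, ht.eventually] with u hu hin
    rw [Function.comp_apply, (hφ u hin).2, hu]
    congr 1; push_cast; ring

/-- If all dilation factors are one, a rational function on `X` that is constant on the fibres
comes from a rational function on `Y`, and rational functions on `Y` pull back. -/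
theorem _root_.TropicalGraph.IsMorphism.isPL_comp_iff (h : IsMorphism M N φ deg)
    (hdeg : ∀ e, deg e = 1) (hsurj : Function.Surjective φ)
    (hfib : ∀ y, (φ ⁻¹' {y}).Finite) {g : Y → EReal} : M.IsPL (g ∘ φ) ↔ N.IsPL g := by
  have hpos : ∀ e, 0 < deg e := fun e => by rw [hdeg]; exact one_pos
  constructor
  · rintro ⟨hc, hfin, S, hS, hloc⟩
    have := M.compactSpace
    have := N.t2
    -- A continuous surjection from a compact space to a Hausdorff space is a quotient map, so
    -- continuity can be tested upstairs.
    have hq := h.continuous.isClosedMap.isQuotientMap h.continuous hsurj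
    refine ⟨hq.continuous_iff.2 hc, fun y hy => ?_, φ '' (S ∪ M.V),
      (hS.union M.V.finite_toSet).image φ, fun e' t' ht' hp => ?_⟩
    · obtain ⟨x, rfl⟩ := hsurj y
      exact h.map_atInfinity hpos (hfin x hy)
    · obtain ⟨x, hx⟩ := hsurj (N.pr e' t')
      have hx' : x ∉ S ∪ M.V := fun h => hp ⟨x, h, hx⟩
      rw [mem_union, not_or] at hx'
      obtain ⟨e, t, ht, rfl⟩ := M.exists_inner_of_notMem hx'.2
      exact (h.locAff_comp_iff hdeg ht ht' hx).1 (hloc e t ht hx'.1)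
  · rintro ⟨hc, hfin, S, hS, hloc⟩
    refine ⟨hc.comp h.continuous, fun x hx => h.atInfinity_of_map hpos hsurj (hfin _ hx),
      φ ⁻¹' (S ∪ N.V), ?_, fun e t ht hp => ?_⟩
    · rw [← biUnion_of_singleton (S ∪ ↑N.V), preimage_iUnion₂]
      exact (hS.union N.V.finite_toSet).biUnion fun y _ => hfib y
    · rw [mem_preimage, mem_union, not_or] at hp
      obtain ⟨e', t', ht', heq⟩ := N.exists_inner_of_notMem hp.2
      exact (h.locAff_comp_iff hdeg ht ht' heq.symm).2 (hloc e' t' ht' (heq ▸ hp.1))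

/-- Since the fibres are the orbits, invariant functions are exactly those that factor through `φ`;
the factor is obtained from any section of `φ`, and `isPL_comp_iff` decides its rationality. -/
theorem _root_.TropicalGraph.IsMorphism.image_ratFun {K : Type*} [Group K] [Finite K]
    [MulAction K X] (h : IsMorphism M N φ deg) (hdeg : ∀ e, deg e = 1)
    (hsurj : Function.Surjective φ) (horb : ∀ x y, φ x = φ y ↔ ∃ σ : K, σ • x = y) :
    (fun g => g ∘ φ) '' RatFun Y = {f | f ∈ RatFun X ∧ IsInvariantFun K f} := by
  have hfib : ∀ y, (φ ⁻¹' {y}).Finite := fun y => by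
    obtain ⟨x, rfl⟩ := hsurj y
    refine (finite_range fun σ : K => σ • x).subset fun z hz => ?_
    obtain ⟨σ, hσ⟩ := (horb x z).1 (Eq.symm hz)
    exact ⟨σ, hσ⟩
  have key : ∀ g : Y → EReal, g ∘ φ ∈ RatFun X ↔ g ∈ RatFun Y := fun g => by
    rw [M.mem_ratFun_iff, N.mem_ratFun_iff, h.isPL_comp_iff hdeg hsurj hfib,
      hsurj.forall (p := fun y => g y = ⊥)]
    rfl
  ext f
  constructor
  · rintro ⟨g, hg, rfl⟩
    refine ⟨(key g).2 hg, fun σ x => ?_⟩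
    exact congrArg g ((horb x (σ • x)).2 ⟨σ, rfl⟩).symm
  · rintro ⟨hf, hinv⟩
    have hcomp : (f ∘ Function.surjInv hsurj) ∘ φ = f := funext fun x => by
      obtain ⟨σ, hσ⟩ := (horb x (Function.surjInv hsurj (φ x))).1
        (Function.surjInv_eq hsurj (φ x)).symm
      change f (Function.surjInv hsurj (φ x)) = f x
      rw [← hσ, hinv]
    exact ⟨f ∘ Function.surjInv hsurj, (key _).1 (hcomp.symm ▸ hf), hcomp⟩

end Pullback

end Model

end TropicalGraph

/-! ### The pullback of rational functions along the covering -/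

theorem mainTheorem9 {Γ : Type*} [TopologicalSpace Γ] [TropicalGraph.GraphDist Γ]
    (hΓ : TropicalGraph.IsMetricGraph Γ)
    {K : Type*} [Group K] [Finite K] [MulAction K Γ]
    (hK : TropicalGraph.IsIsometricAction K Γ)
    (D : Γ →₀ ℤ) (hD : 0 ≤ D) (hDK : TropicalGraph.IsInvariantDiv K D)
    {n : ℕ} (F : Fin (n + 1) → Γ → EReal)
    (hF : TropicalGraph.Generates K F D) (hF' : ∀ i, ∃ x, F i x ≠ ⊥)
    (hφ : TropicalGraph.IsGaloisCovering K
      (Set.rangeFactorization (TropicalGraph.ratMap F))) :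
    (fun g => g ∘ Set.rangeFactorization (TropicalGraph.ratMap F)) ''
        TropicalGraph.RatFun (Set.range (TropicalGraph.ratMap F)) =
      {f | f ∈ TropicalGraph.RatFun Γ ∧ TropicalGraph.IsInvariantFun K f} := by
  obtain ⟨M, N, deg, m, m', -, -, hmor, hdeg, -, -, horb⟩ := hφ
  refine hmor.image_ratFun (fun e => ?_) Set.rangeFactorization_surjective horb
  obtain ⟨e', flip, h⟩ := hmor.exists_dilation hdeg e
  exact TropicalGraph.Model.deg_eq_one hK hD hF hF' (hdeg e) h
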